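/- Let $\mathcal Q=\{(u,v): 1\le u\le v<\infty\}$, with axis $\Gamma=\{u=v\}$, and for real functions on $\mathcal Q$ let $C_u=\{u\}\times[u,\infty)$ and $\underline C_v=[1,v]\times\{v\}$. First derivatives $\partial_v f$, $\partial_u f$ of functions whose derivatives have bounded variation denote the right-continuous representatives (i.e. derivatives from the right; $\partial_u$ is considered off the axis), and T.V. denotes total variation. For $(\phi,r,m)$ on $\mathcal Q$ put $\lambda=\partial_v r$, $\nu=\partial_u r$, $\mu=2m/r$, $\Omega^2=-4\lambda\nu/(1-\mu)$. *Solutions.* $(\phi,r,m)$ is a solution of the spherically symmetric Einstein–scalar field system if $r>0$ and $\Omega^2>0$ on $\mathcal Q\setminus\Gamma$, $r=m=0$ on $\Gamma$, $v=2r+1$ on $C_1$ (so $\lambda(1,\cdot)=\tfrac12$), and $$\partial_u\lambda=\partial_v\nu=\frac{\mu\lambda\nu}{(1-\mu)r},\quad 2\nu\,\partial_u m=(1-\mu)r^2(\partial_u\phi)^2,\quad 2\lambda\,\partial_v m=(1-\mu)r^2(\partial_v\phi)^2,\quad \partial_u\partial_v(r\phi)=\partial_v\partial_u(r\phi)=\frac{\mu\lambda\nu}{(1-\mu)r}\phi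 ,$$ where along every null curve $r,\phi,m$ are absolutely continuous up to the axis, $\lambda,\partial_v(r\phi)$ (in $u$) and $\nu,\partial_u(r\phi)$ (in $v$) are locally absolutely continuous off the axis, and the equations hold almost everywhere. It is a *BV solution* if on each $\mathcal D(u_0,v_0)=\{u_0\le u\le v\le v_0\}$ ($1\le u_0\le v_0$): $\sup(-\nu)<\infty$; $\lambda>0$ and $\sup\lambda^{-1}<\infty$; $\lambda$, $\phi$, $\partial_v(r\phi)$ have total variation on $C_u\cap\mathcal D(u_0,v_0)$ bounded uniformly in $u$, and $\nu$, $\phi$, $\partial_u(r\phi)$ have total variation on $\underline C_v\cap\mathcal D(u_0,v_0)$ bounded uniformly in $v$; and if for every $a\ge1$ $$\lim_{\epsilon\to0+}(\nu+\lambda)(a,a+\epsilon)=0,\qquad \lim_{\epsilon\to0+}\big(\partial_v(r\phi)+\partial_u(r\phi)\big)(a,a+\epsilon)=0,$$ $$\lim_{\epsilon\to0+}\sup_{0<\delta\le\epsilon}\mathrm{T.V.}_{(a,a+\delta)\times\{a+\delta\}}[\phi]=\lim_{\epsilon\to0+}\sup_{0<\delta\le\epsilon}\mathrm{T.V.}_{\{a+\delta\}\times(a+\delta,a+\epsilon)}[\phi]=0,$$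 and for every $a>1$ $$\lim_{\epsilon\to0+}\sup_{0<\delta\le\epsilon}\mathrm{T.V.}_{\{a-\delta\}\times(a-\delta,a)}[\phi]=\lim_{\epsilon\to0+}\sup_{0<\delta\le\epsilon}\mathrm{T.V.}_{(a-\epsilon,a-\delta)\times\{a-\delta\}}[\phi]=0 .$$ A BV solution is *locally BV scattering* if (1) $\int_u^\infty\Omega^2(u,v)\,dv=\infty$ for every $u\ge1$ (outgoing radial null geodesics are future complete; the incoming ones end on $\Gamma$); (2) the Bondi mass $M(u)=\lim_{v\to\infty}m(u,v)$ exists for every $u \geq 1$ and $\lim_{u\to\infty}M(u)=0$; (3) for some $R>0$, the total variations of $\partial_v(r\phi)$ and of $\log\lambda$ on $C_u\cap\{r\le R\}$ tend to $0$ as $u\to\infty$. The initial data are *asymptotically flat of order $\omega'>1$ in BV* if $\partial_v(r\phi)(1,\cdot)$ has finite total variation on $[1,\infty)$ and $\sup_{C_1}(1+r)^{\omega'}|\partial_v(r\phi)|<\infty$. **Theorem.** Let $(\phi,r,m)$ be a locally BV scattering solution whose initial data are asymptotically flat of order $\omega'>1$ in BV, and let $\omega=\min\{\omega',3\}$. Then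 there is a constant $A_1>0$ (depending on the solution) such that on $\mathcal Q$ $$|\phi|\le A_1\min\{u^{-\omega},\,r^{-1}u^{-(\omega-1)}\},\qquad |\partial_v(r\phi)|\le A_1\min\{u^{-\omega},\,r^{-\omega}\},\qquad |\partial_u(r\phi)|\le A_1u^{-\omega},$$ where on the axis $r=0$ the first two minima are read as $u^{-\omega}$ and the third bound is asserted off the axis. -/

import Mathlib

open Set Filter Topology MeasureTheory
open scoped ENNReal NNReal

namespace SSESF

/-!
The quotient spacetime is `Q = {(u, v) : 1 ≤ u, u ≤ v}` with axis `Γ = {u = v}` and initial curve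
`C₁ = {u = 1}`. A function on `Q` is written in curried form `f u v`; only its values on `Q` matter.
-/

/-- `∂_v f (u, v)`, as a derivative from the right. If `f u` is absolutely continuous and its almost
everywhere derivative has bounded variation, this is the right-continuous representative of the
distributional derivative. -/
noncomputable def dv (f : ℝ → ℝ → ℝ) (u v : ℝ) : ℝ :=
  derivWithin (fun v' => f u v') (Ioi v) v

/-- `∂_u f (u, v)`, as a derivative from the right; used only at points `u < v`, off the axis. -/
noncomputable def du (f : ℝ → ℝ → ℝ) (u v : ℝ) : ℝ :=
  derivWithin (fun u' => f u' v) (Ioi u) u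

/-- The mass ratio `μ = 2 m / r`. -/
noncomputable def massRatio (r m : ℝ → ℝ → ℝ) (u v : ℝ) : ℝ := 2 * m u v / r u v

/-- The function `Ω²` of the metric `-Ω² du dv + r² ds²_{S²}`, expressed through
`1 - 2 m / r = -4 Ω⁻² ∂_u r ∂_v r`. -/
noncomputable def omegaSq (r m : ℝ → ℝ → ℝ) (u v : ℝ) : ℝ :=
  -4 * du r u v * dv r u v / (1 - massRatio r m u v)

/-- The common right-hand side `μ λ ν / ((1 - μ) r)` of the equations for `∂_u λ` and `∂_v ν`,
with `λ = ∂_v r` and `ν = ∂_u r`. -/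
noncomputable def potential (r m : ℝ → ℝ → ℝ) (u v : ℝ) : ℝ :=
  massRatio r m u v / ((1 - massRatio r m u v) * r u v) * dv r u v * du r u v

/-- `(φ, r, m)` solves the spherically symmetric Einstein–scalar field system on `Q`, in the double
null coordinates normalized by `v = 2 r + 1` on `C₁` and `Γ = {u = v}`. Each equation holds
almost everywhere along every null curve of `Q`, the differentiated quantity being absolutely
continuous along that curve (up to the axis for `r`, `φ` and `m`, and off the axis for the first
derivatives of `r` and of `r φ`). -/
structure IsSolution (φ r m : ℝ → ℝ → ℝ) : Prop where
  r_axis : ∀ u, 1 ≤ u → r u u = 0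
  r_pos : ∀ u v, 1 ≤ u → u < v → 0 < r u v
  r_initial : ∀ v, 1 ≤ v → v = 2 * r 1 v + 1
  m_axis : ∀ u, 1 ≤ u → m u u = 0
  omegaSq_pos : ∀ u v, 1 ≤ u → u < v → 0 < omegaSq r m u v
  r_ac_v : ∀ u v, 1 ≤ u → u ≤ v → AbsolutelyContinuousOnInterval (fun v' => r u v') u v
  r_ac_u : ∀ v, 1 ≤ v → AbsolutelyContinuousOnInterval (fun u' => r u' v) 1 v
  phi_ac_v : ∀ u v, 1 ≤ u → u ≤ v → AbsolutelyContinuousOnInterval (fun v' => φ u v') u v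
  phi_ac_u : ∀ v, 1 ≤ v → AbsolutelyContinuousOnInterval (fun u' => φ u' v) 1 v
  m_ac_v : ∀ u v, 1 ≤ u → u ≤ v → AbsolutelyContinuousOnInterval (fun v' => m u v') u v
  m_ac_u : ∀ v, 1 ≤ v → AbsolutelyContinuousOnInterval (fun u' => m u' v) 1 v
  lam_ac : ∀ u v, 1 ≤ u → u < v → AbsolutelyContinuousOnInterval (fun u' => dv r u' v) 1 u
  nu_ac : ∀ u v₁ v₂, 1 ≤ u → u < v₁ → v₁ ≤ v₂ →
    AbsolutelyContinuousOnInterval (fun v' => du r u v') v₁ v₂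
  dv_rphi_ac : ∀ u v, 1 ≤ u → u < v →
    AbsolutelyContinuousOnInterval (fun u' => dv (r * φ) u' v) 1 u
  du_rphi_ac : ∀ u v₁ v₂, 1 ≤ u → u < v₁ → v₁ ≤ v₂ →
    AbsolutelyContinuousOnInterval (fun v' => du (r * φ) u v') v₁ v₂
  eq_du_lam : ∀ v, 1 < v → ∀ᵐ u, u ∈ Ioo 1 v → du (dv r) u v = potential r m u v
  eq_dv_nu : ∀ u, 1 ≤ u → ∀ᵐ v, v ∈ Ioi u → dv (du r) u v = potential r m u v
  eq_du_m : ∀ v, 1 < v → ∀ᵐ u, u ∈ Ioo 1 v →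
    2 * du r u v * du m u v = (1 - massRatio r m u v) * r u v ^ 2 * du φ u v ^ 2
  eq_dv_m : ∀ u, 1 ≤ u → ∀ᵐ v, v ∈ Ioi u →
    2 * dv r u v * dv m u v = (1 - massRatio r m u v) * r u v ^ 2 * dv φ u v ^ 2
  eq_wave_uv : ∀ v, 1 < v → ∀ᵐ u, u ∈ Ioo 1 v →
    du (dv (r * φ)) u v = potential r m u v * φ u v
  eq_wave_vu : ∀ u, 1 ≤ u → ∀ᵐ v, v ∈ Ioi u →
    dv (du (r * φ)) u v = potential r m u v * φ u v

/-- The regularity required of a solution of bounded variation on the domain of dependence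
`D(u₀, v₀) = {(u, v) : u₀ ≤ u ≤ v ≤ v₀}`. The part of `C_u` in it is `{u} × [u, v₀]`, and the part
of `C̲_v` in it, without the point on the axis, is `[u₀, v) × {v}`. -/
structure IsBVOn (φ r : ℝ → ℝ → ℝ) (u₀ v₀ : ℝ) : Prop where
  neg_nu_bdd : ∃ C : ℝ, ∀ u v, u₀ ≤ u → u < v → v ≤ v₀ → -du r u v ≤ C
  lam_inv_bdd : ∃ C : ℝ, ∀ u v, u₀ ≤ u → u ≤ v → v ≤ v₀ → 0 < dv r u v ∧ (dv r u v)⁻¹ ≤ C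
  lam_bv : ∃ C : ℝ≥0, ∀ u ∈ Icc u₀ v₀, eVariationOn (fun v => dv r u v) (Icc u v₀) ≤ C
  nu_bv : ∃ C : ℝ≥0, ∀ v ∈ Icc u₀ v₀, eVariationOn (fun u => du r u v) (Ico u₀ v) ≤ C
  phi_bv_v : ∃ C : ℝ≥0, ∀ u ∈ Icc u₀ v₀, eVariationOn (fun v => φ u v) (Icc u v₀) ≤ C
  phi_bv_u : ∃ C : ℝ≥0, ∀ v ∈ Icc u₀ v₀, eVariationOn (fun u => φ u v) (Icc u₀ v) ≤ C
  dv_rphi_bv : ∃ C : ℝ≥0, ∀ u ∈ Icc u₀ v₀,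
    eVariationOn (fun v => dv (r * φ) u v) (Icc u v₀) ≤ C
  du_rphi_bv : ∃ C : ℝ≥0, ∀ v ∈ Icc u₀ v₀,
    eVariationOn (fun u => du (r * φ) u v) (Ico u₀ v) ≤ C

/-- Solutions of bounded variation. The conditions `phi_axis_past_*` concern points in the past of
`(a, a)`, which exist in `Q` only for `1 < a`. -/
structure IsBVSolution (φ r m : ℝ → ℝ → ℝ) : Prop extends IsSolution φ r m where
  bv_on : ∀ u₀ v₀, 1 ≤ u₀ → u₀ ≤ v₀ → IsBVOn φ r u₀ v₀
  nu_add_lam_axis : ∀ a, 1 ≤ a →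
    Tendsto (fun ε => du r a (a + ε) + dv r a (a + ε)) (𝓝[>] 0) (𝓝 0)
  phi_axis_past_v : ∀ a, 1 < a →
    Tendsto (fun ε : ℝ => ⨆ δ ∈ Ioc 0 ε,
      eVariationOn (fun v => φ (a - δ) v) (Ioo (a - δ) a)) (𝓝[>] 0) (𝓝 0)
  phi_axis_past_u : ∀ a, 1 < a →
    Tendsto (fun ε : ℝ => ⨆ δ ∈ Ioc 0 ε,
      eVariationOn (fun u => φ u (a - δ)) (Ioo (a - ε) (a - δ))) (𝓝[>] 0) (𝓝 0)
  phi_axis_future_u : ∀ a, 1 ≤ a →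
    Tendsto (fun ε : ℝ => ⨆ δ ∈ Ioc 0 ε,
      eVariationOn (fun u => φ u (a + δ)) (Ioo a (a + δ))) (𝓝[>] 0) (𝓝 0)
  phi_axis_future_v : ∀ a, 1 ≤ a →
    Tendsto (fun ε : ℝ => ⨆ δ ∈ Ioc 0 ε,
      eVariationOn (fun v => φ (a + δ) v) (Ioo (a + δ) (a + ε))) (𝓝[>] 0) (𝓝 0)
  rphi_axis : ∀ a, 1 ≤ a →
    Tendsto (fun ε => dv (r * φ) a (a + ε) + du (r * φ) a (a + ε)) (𝓝[>] 0) (𝓝 0)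

/-- Locally BV scattering solutions. On the global domain `Q` every incoming radial null geodesic
ends on the axis; the affine parameter along the outgoing radial null geodesic `C_u` is
`∫ Ω² dv`. The integrals of `|∂_v² (r φ)|` and `|∂_v log λ|` over `C_u ∩ {r ≤ R}` are the total
variations of `∂_v (r φ)` and of `log λ` there. -/
structure IsLocallyBVScattering (φ r m : ℝ → ℝ → ℝ) : Prop extends IsBVSolution φ r m where
  outgoing_complete : ∀ u, 1 ≤ u → ∫⁻ v in Ioi u, ENNReal.ofReal (omegaSq r m u v) = ∞
  final_bondi_mass : ∃ M : ℝ → ℝ, (∀ u, 1 ≤ u → Tendsto (fun v => m u v) atTop (𝓝 (M u))) ∧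
    Tendsto M atTop (𝓝 0)
  scattering : ∃ R : ℝ, 0 < R ∧
    Tendsto (fun u => eVariationOn (fun v => dv (r * φ) u v) {v | u ≤ v ∧ r u v ≤ R})
      atTop (𝓝 0) ∧
    Tendsto (fun u => eVariationOn (fun v => Real.log (dv r u v)) {v | u ≤ v ∧ r u v ≤ R})
      atTop (𝓝 0)

/-- The initial data on `C₁` are asymptotically flat of order `ω'` in BV. -/
def IsAsymptoticallyFlatBV (φ r : ℝ → ℝ → ℝ) (ω' : ℝ) : Prop :=
  BoundedVariationOn (fun v => dv (r * φ) 1 v) (Ici 1) ∧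
  ∃ I₁ : ℝ, 0 < I₁ ∧ ∀ v, 1 ≤ v → (1 + r 1 v) ^ ω' * |dv (r * φ) 1 v| ≤ I₁

end SSESF

/-! ### Absolutely continuous functions -/

namespace AbsolutelyContinuousOnInterval

variable {f g : ℝ → ℝ} {a b : ℝ}

/-! The proof is an absorption argument for `∂_v (r φ)`. The wave equation reads `∂_u ∂_v (r φ) = φ
∂_u λ`, with `∂_u λ ≤ 0`. Along an incoming curve `∂_v (r φ)` therefore changes by at most `sup |φ|`
times the drop of `λ` (`abs_dv_rphi_sub_le_lam`). Since `r = 0` on the axis, `φ` is the average of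
`∂_v (r φ) / λ` over `C_u` with weight `λ dv`, so `φ` is controlled by `∂_v (r φ)` again
(`abs_phi_le`). The loop contracts once `λ` has little room left to drop.

That smallness comes from scattering. Future completeness and the local variation bounds force `r →
∞` on each `C_u` (`exists_r_ge`). The small variation of `log λ` in `r ≤ R` and the small Bondi mass
outside then give `λ → 1/2` uniformly (`exists_forall_log_lam_ge`).

The unweighted loop bounds `∂_v (r φ)` (`exists_abs_dv_rphi_le`). This bound and the small
variations in `r ≤ R` give a uniform bound for `ν` (`neg_nu_le_of_variation`, `exists_neg_nu_le`).

The loop is then run with the weight `v ^ ω` (`exists_abs_dv_rphi_le_rpow`). Where `v ≤ 2u`, `u ^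
(-ω)` is comparable to `v ^ (-ω)` and the drop of `λ` is small. Where `v > 2u`, the source is at
most a multiple of `v⁻³ |r φ|` with `|r φ|` of order `u ^ (1 - ω)`; as `ω ≤ 3`, this is of order
`u⁻² v ^ (-ω)`, whose integral over late `u` is small. Each loop is closed by
`le_two_mul_of_improvable`, which needs a finite bound beforehand; this comes from estimates on `u ≤
U` with constants depending on `U`. The stated rates follow from `v ≥ u`, `v ≥ r`, averaging, and
integrating the wave equation in `v` from the axis for `∂_u (r φ)`. -/

theorem _root_.HasDerivAt.derivWithin_Ioi {f' x : ℝ} (h : HasDerivAt f f' x) :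
    derivWithin f (Ioi x) x = f' :=
  h.hasDerivWithinAt.derivWithin (uniqueDiffWithinAt_Ioi x)

/-- An absolutely continuous function is differentiable almost everywhere, with derivative its
derivative from the right. -/
theorem ae_hasDerivAt_derivWithin_Ioi (hf : AbsolutelyContinuousOnInterval f a b) :
    ∀ᵐ x, x ∈ uIcc a b → HasDerivAt f (derivWithin f (Ioi x) x) x := by
  filter_upwards [hf.ae_differentiableAt] with x hx hxab
  have := (hx hxab).hasDerivAt
  rwa [this.derivWithin_Ioi]

/-- The hypothesis ranges over every candidate derivative, so that in applications
`HasDerivAt.unique` replaces it by the expression supplied by the field equations. -/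
theorem le_of_ae_deriv_nonneg (hab : a ≤ b) (hf : AbsolutelyContinuousOnInterval f a b)
    (h : ∀ᵐ x, x ∈ Ioo a b → ∀ f', HasDerivAt f f' x → 0 ≤ f') : f a ≤ f b := by
  have key : 0 ≤ ∫ x in a..b, deriv f x := by
    rw [intervalIntegral.integral_of_le hab]
    apply setIntegral_nonneg_of_ae_restrict
    rw [EventuallyLE, ae_restrict_iff' measurableSet_Ioc]
    filter_upwards [h, hf.ae_differentiableAt, (volume : Measure ℝ).ae_ne b] with x h1 h2 h3 hx
    exact h1 ⟨hx.1, lt_of_le_of_ne hx.2 h3⟩ _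
      (h2 (by rw [uIcc_of_le hab]; exact Ioc_subset_Icc_self hx)).hasDerivAt
  rw [hf.integral_deriv_eq_sub] at key
  linarith

/-- A function whose derivative is dominated by that of another one has smaller increments. -/
theorem abs_sub_le_of_ae_abs_deriv_le (hab : a ≤ b) (hf : AbsolutelyContinuousOnInterval f a b)
    (hg : AbsolutelyContinuousOnInterval g a b)
    (h : ∀ᵐ x, x ∈ Ioo a b → ∀ f' g', HasDerivAt f f' x → HasDerivAt g g' x → |f'| ≤ g') :
    |f b - f a| ≤ g b - g a := by
  have h1 : g a - f a ≤ g b - f b := by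
    refine le_of_ae_deriv_nonneg (f := fun x => g x - f x) hab (hg.fun_sub hf) ?_
    filter_upwards [h, hf.ae_differentiableAt, hg.ae_differentiableAt] with x hx hfx hgx hxab k hk
    have hm : x ∈ uIcc a b := by rw [uIcc_of_le hab]; exact Ioo_subset_Icc_self hxab
    have e := hk.unique ((hgx hm).hasDerivAt.sub (hfx hm).hasDerivAt)
    have := (abs_le.1 (hx hxab _ _ (hfx hm).hasDerivAt (hgx hm).hasDerivAt)).2
    linarith
  have h2 : g a + f a ≤ g b + f b := by
    refine le_of_ae_deriv_nonneg (f := fun x => g x + f x) hab (hg.fun_add hf) ?_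
    filter_upwards [h, hf.ae_differentiableAt, hg.ae_differentiableAt] with x hx hfx hgx hxab k hk
    have hm : x ∈ uIcc a b := by rw [uIcc_of_le hab]; exact Ioo_subset_Icc_self hxab
    have e := hk.unique ((hgx hm).hasDerivAt.add (hfx hm).hasDerivAt)
    have := (abs_le.1 (hx hxab _ _ (hfx hm).hasDerivAt (hgx hm).hasDerivAt)).1
    linarith
  rw [abs_le]
  constructor <;> linarith

theorem lipschitzOnWith_comp {F : ℝ → ℝ} {s : Set ℝ} {K : ℝ≥0} (hF : LipschitzOnWith K F s)
    (hf : AbsolutelyContinuousOnInterval f a b) (hs : MapsTo f (uIcc a b) s) :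
    AbsolutelyContinuousOnInterval (fun x => F (f x)) a b := by
  unfold AbsolutelyContinuousOnInterval at hf ⊢
  refine squeeze_zero' ?_ ?_ (by simpa using hf.const_mul (K : ℝ))
  · exact Eventually.of_forall fun _ => Finset.sum_nonneg fun i _ => dist_nonneg
  · rw [eventually_inf_principal]
    filter_upwards with E hE
    rw [Finset.mul_sum]
    exact Finset.sum_le_sum fun i hi =>
      hF.dist_le_mul _ (hs (hE.1 i hi).1) _ (hs (hE.1 i hi).2)

/-- Composition of a positive absolutely continuous function with a `C¹` function on `(0, ∞)`. -/
theorem contDiffOn_comp_of_pos {F : ℝ → ℝ} (hF : ContDiffOn ℝ 1 F (Ioi 0))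
    (hf : AbsolutelyContinuousOnInterval f a b) (hpos : ∀ x ∈ uIcc a b, 0 < f x) :
    AbsolutelyContinuousOnInterval (fun x => F (f x)) a b := by
  obtain ⟨x₀, hx₀, hmin⟩ := isCompact_uIcc.exists_isMinOn nonempty_uIcc hf.continuousOn
  obtain ⟨x₁, hx₁, hmax⟩ := isCompact_uIcc.exists_isMaxOn nonempty_uIcc hf.continuousOn
  have hsub : Icc (f x₀) (f x₁) ⊆ Ioi 0 := fun y hy => (hpos x₀ hx₀).trans_le hy.1
  obtain ⟨K, hK⟩ := (hF.mono hsub).exists_lipschitzOnWith (by decide) (convex_Icc _ _)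
    isCompact_Icc
  exact lipschitzOnWith_comp hK hf fun x hx => ⟨hmin hx, hmax hx⟩

theorem log_of_pos (hf : AbsolutelyContinuousOnInterval f a b) (hpos : ∀ x ∈ uIcc a b, 0 < f x) :
    AbsolutelyContinuousOnInterval (fun x => Real.log (f x)) a b :=
  contDiffOn_comp_of_pos (fun _ hx => (Real.contDiffAt_log.2 (ne_of_gt hx)).contDiffWithinAt)
    hf hpos

theorem inv_of_pos (hf : AbsolutelyContinuousOnInterval f a b) (hpos : ∀ x ∈ uIcc a b, 0 < f x) :
    AbsolutelyContinuousOnInterval (fun x => (f x)⁻¹) a b :=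
  contDiffOn_comp_of_pos (fun _ hx => (contDiffAt_inv ℝ (ne_of_gt hx)).contDiffWithinAt)
    hf hpos

theorem id (a b : ℝ) : AbsolutelyContinuousOnInterval (fun x => x) a b :=
  contDiff_id.contDiffOn.absolutelyContinuousOnInterval

theorem mono_Icc {c d : ℝ} (hf : AbsolutelyContinuousOnInterval f a b) (hac : a ≤ c) (hcd : c ≤ d)
    (hdb : d ≤ b) : AbsolutelyContinuousOnInterval f c d :=
  hf.mono (by
    rw [uIcc_of_le hcd, uIcc_of_le (hac.trans (hcd.trans hdb))]
    exact Icc_subset_Icc hac hdb)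

/-- Countably many compact intervals exhaust the half-line. The endpoint is left out because `ν` and
`∂_u (r φ)` are absolutely continuous only off the axis. -/
theorem ae_hasDerivAt_of_Ioi {c : ℝ}
    (h : ∀ a b, c < a → a ≤ b → AbsolutelyContinuousOnInterval f a b) :
    ∀ᵐ x, x ∈ Ioi c → HasDerivAt f (derivWithin f (Ioi x) x) x := by
  have h1 : ∀ᵐ x, ∀ n : ℕ, x ∈ Icc (c + 1 / ((n : ℝ) + 1)) (c + 1 / ((n : ℝ) + 1) + n) →
      HasDerivAt f (derivWithin f (Ioi x) x) x := by
    rw [ae_all_iff]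
    intro n
    have hn : (0 : ℝ) < 1 / ((n : ℝ) + 1) := by positivity
    have := (h (c + 1 / ((n : ℝ) + 1)) (c + 1 / ((n : ℝ) + 1) + n) (by linarith)
      (by linarith [n.cast_nonneg (α := ℝ)])).ae_hasDerivAt_derivWithin_Ioi
    rwa [uIcc_of_le (by linarith [n.cast_nonneg (α := ℝ)])] at this
  filter_upwards [h1] with x hx hxc
  rw [mem_Ioi] at hxc
  obtain ⟨n₁, hn₁⟩ := exists_nat_one_div_lt (sub_pos.2 hxc)
  obtain ⟨n₂, hn₂⟩ := exists_nat_ge (x - c)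
  refine hx (max n₁ n₂) ⟨?_, ?_⟩
  · have : 1 / (((max n₁ n₂ : ℕ) : ℝ) + 1) ≤ 1 / ((n₁ : ℝ) + 1) := by
      gcongr
      exact le_max_left _ _
    linarith
  · have h2 : (n₂ : ℝ) ≤ (max n₁ n₂ : ℕ) := by exact_mod_cast le_max_right _ _
    have h3 : (0 : ℝ) < 1 / (((max n₁ n₂ : ℕ) : ℝ) + 1) := by positivity
    linarith

theorem ae_hasDerivAt_of_Ioo {c : ℝ}
    (h : ∀ b, a ≤ b → b < c → AbsolutelyContinuousOnInterval f a b) :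
    ∀ᵐ x, x ∈ Ioo a c → HasDerivAt f (derivWithin f (Ioi x) x) x := by
  have h1 : ∀ᵐ x, ∀ n : ℕ, x ∈ Icc a (c - 1 / ((n : ℝ) + 1)) →
      HasDerivAt f (derivWithin f (Ioi x) x) x := by
    rw [ae_all_iff]
    intro n
    have hn : (0 : ℝ) < 1 / ((n : ℝ) + 1) := by positivity
    rcases le_or_gt a (c - 1 / ((n : ℝ) + 1)) with hle | hlt
    · have := (h _ hle (by linarith)).ae_hasDerivAt_derivWithin_Ioi
      rwa [uIcc_of_le hle] at this
    · filter_upwards with x hx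
      exact absurd (hx.1.trans hx.2) (not_le.2 hlt)
  filter_upwards [h1] with x hx hxc
  obtain ⟨n, hn⟩ := exists_nat_one_div_lt (sub_pos.2 hxc.2)
  exact hx n ⟨hxc.1.le, by linarith⟩

end AbsolutelyContinuousOnInterval

/-- A bounded family whose every upper bound `X` can be improved to `C + X / 2` is bounded by
`2 * C`. -/
theorem le_two_mul_of_improvable {ι : Type*} {F : ι → ℝ} {C : ℝ} (hb : BddAbove (range F))
    (h : ∀ X, (∀ i, F i ≤ X) → ∀ i, F i ≤ C + X / 2) (i : ι) : F i ≤ 2 * C := by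
  have : Nonempty ι := ⟨i⟩
  have h1 : ∀ j, F j ≤ ⨆ k, F k := fun j => le_ciSup hb j
  have h2 : (⨆ k, F k) ≤ C + (⨆ k, F k) / 2 := ciSup_le (h _ h1)
  linarith [h1 i]

namespace SSESF

variable {φ r m : ℝ → ℝ → ℝ}

/-! ### The equations along null curves -/

theorem IsSolution.rphi_ac_v (h : IsSolution φ r m) {u v : ℝ} (hu : 1 ≤ u) (huv : u ≤ v) :
    AbsolutelyContinuousOnInterval (fun v' => (r * φ) u v') u v :=
  (h.r_ac_v u v hu huv).fun_mul (h.phi_ac_v u v hu huv)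

theorem ae_hasDerivAt_dv {f : ℝ → ℝ → ℝ} {u : ℝ}
    (hf : ∀ v₁ v₂, u < v₁ → v₁ ≤ v₂ → AbsolutelyContinuousOnInterval (fun v' => f u v') v₁ v₂) :
    ∀ᵐ v, v ∈ Ioi u → HasDerivAt (fun v' => f u v') (dv f u v) v :=
  AbsolutelyContinuousOnInterval.ae_hasDerivAt_of_Ioi hf

theorem ae_hasDerivAt_du {f : ℝ → ℝ → ℝ} {v : ℝ}
    (hf : ∀ u, 1 ≤ u → u < v → AbsolutelyContinuousOnInterval (fun u' => f u' v) 1 u) :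
    ∀ᵐ u, u ∈ Ioo 1 v → HasDerivAt (fun u' => f u' v) (du f u v) u :=
  AbsolutelyContinuousOnInterval.ae_hasDerivAt_of_Ioo hf

theorem IsSolution.ae_r_v (h : IsSolution φ r m) {u : ℝ} (hu : 1 ≤ u) :
    ∀ᵐ v, v ∈ Ioi u → HasDerivAt (fun v' => r u v') (dv r u v) v :=
  ae_hasDerivAt_dv fun _ v₂ h₁ h₂ =>
    (h.r_ac_v u v₂ hu (h₁.le.trans h₂)).mono_Icc h₁.le h₂ le_rfl

theorem IsSolution.ae_phi_v (h : IsSolution φ r m) {u : ℝ} (hu : 1 ≤ u) :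
    ∀ᵐ v, v ∈ Ioi u → HasDerivAt (fun v' => φ u v') (dv φ u v) v :=
  ae_hasDerivAt_dv fun _ v₂ h₁ h₂ =>
    (h.phi_ac_v u v₂ hu (h₁.le.trans h₂)).mono_Icc h₁.le h₂ le_rfl

theorem IsSolution.ae_m_v (h : IsSolution φ r m) {u : ℝ} (hu : 1 ≤ u) :
    ∀ᵐ v, v ∈ Ioi u → HasDerivAt (fun v' => m u v') (dv m u v) v :=
  ae_hasDerivAt_dv fun _ v₂ h₁ h₂ =>
    (h.m_ac_v u v₂ hu (h₁.le.trans h₂)).mono_Icc h₁.le h₂ le_rfl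

theorem IsSolution.ae_rphi_v (h : IsSolution φ r m) {u : ℝ} (hu : 1 ≤ u) :
    ∀ᵐ v, v ∈ Ioi u → HasDerivAt (fun v' => (r * φ) u v') (dv (r * φ) u v) v :=
  ae_hasDerivAt_dv fun _ _ h₁ h₂ =>
    (h.rphi_ac_v hu (h₁.le.trans h₂)).mono_Icc h₁.le h₂ le_rfl

theorem IsSolution.ae_nu_v (h : IsSolution φ r m) {u : ℝ} (hu : 1 ≤ u) :
    ∀ᵐ v, v ∈ Ioi u → HasDerivAt (fun v' => du r u v') (potential r m u v) v := by
  filter_upwards [h.eq_dv_nu u hu, ae_hasDerivAt_dv (f := du r) fun v₁ v₂ h₁ h₂ =>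
    h.nu_ac u v₁ v₂ hu h₁ h₂] with v h1 h2 hv
  rw [← h1 hv]; exact h2 hv

theorem IsSolution.ae_du_rphi_v (h : IsSolution φ r m) {u : ℝ} (hu : 1 ≤ u) :
    ∀ᵐ v, v ∈ Ioi u →
      HasDerivAt (fun v' => du (r * φ) u v') (potential r m u v * φ u v) v := by
  filter_upwards [h.eq_wave_vu u hu, ae_hasDerivAt_dv (f := du (r * φ)) fun v₁ v₂ h₁ h₂ =>
    h.du_rphi_ac u v₁ v₂ hu h₁ h₂] with v h1 h2 hv
  rw [← h1 hv]; exact h2 hv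

theorem IsSolution.ae_r_u (h : IsSolution φ r m) {v : ℝ} (hv : 1 < v) :
    ∀ᵐ u, u ∈ Ioo 1 v → HasDerivAt (fun u' => r u' v) (du r u v) u :=
  ae_hasDerivAt_du fun _ h₁ h₂ => (h.r_ac_u v hv.le).mono_Icc le_rfl h₁ h₂.le

theorem IsSolution.ae_m_u (h : IsSolution φ r m) {v : ℝ} (hv : 1 < v) :
    ∀ᵐ u, u ∈ Ioo 1 v → HasDerivAt (fun u' => m u' v) (du m u v) u :=
  ae_hasDerivAt_du fun _ h₁ h₂ => (h.m_ac_u v hv.le).mono_Icc le_rfl h₁ h₂.le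

theorem IsSolution.ae_lam_u (h : IsSolution φ r m) {v : ℝ} (hv : 1 < v) :
    ∀ᵐ u, u ∈ Ioo 1 v → HasDerivAt (fun u' => dv r u' v) (potential r m u v) u := by
  filter_upwards [h.eq_du_lam v hv, ae_hasDerivAt_du (f := dv r) fun u h₁ h₂ =>
    h.lam_ac u v h₁ h₂] with u h1 h2 hu
  rw [← h1 hu]; exact h2 hu

theorem IsSolution.ae_dv_rphi_u (h : IsSolution φ r m) {v : ℝ} (hv : 1 < v) :
    ∀ᵐ u, u ∈ Ioo 1 v →
      HasDerivAt (fun u' => dv (r * φ) u' v) (potential r m u v * φ u v) u := by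
  filter_upwards [h.eq_wave_uv v hv, ae_hasDerivAt_du (f := dv (r * φ)) fun u h₁ h₂ =>
    h.dv_rphi_ac u v h₁ h₂] with u h1 h2 hu
  rw [← h1 hu]; exact h2 hu

/-! ### Signs and monotonicity -/

theorem IsBVSolution.lam_pos (h : IsBVSolution φ r m) {u v : ℝ} (hu : 1 ≤ u) (huv : u ≤ v) :
    0 < dv r u v := by
  obtain ⟨C, hC⟩ := (h.bv_on u v hu huv).lam_inv_bdd
  exact (hC u v le_rfl huv le_rfl).1

theorem IsSolution.nu_ne_zero (h : IsSolution φ r m) {u v : ℝ} (hu : 1 ≤ u) (huv : u < v) :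
    du r u v ≠ 0 := by
  intro h0
  have := h.omegaSq_pos u v hu huv
  simp [omegaSq, h0] at this

/-- Near the axis `ν` is close to `-λ`, and `λ` is bounded below there. -/
theorem IsBVSolution.nu_neg_near_axis (h : IsBVSolution φ r m) {u : ℝ} (hu : 1 ≤ u) :
    ∀ᶠ ε in 𝓝[>] (0 : ℝ), du r u (u + ε) < 0 := by
  obtain ⟨C, hC⟩ := (h.bv_on u (u + 1) hu (by linarith)).lam_inv_bdd
  have hCpos : 0 < C := by
    have := hC u u le_rfl le_rfl (by linarith)
    exact (inv_pos.2 this.1).trans_le this.2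
  filter_upwards [(h.nu_add_lam_axis u hu).eventually (gt_mem_nhds (inv_pos.2 hCpos)),
    Ioo_mem_nhdsGT one_pos] with ε h1 h2
  have h3 := hC u (u + ε) le_rfl (by linarith [h2.1]) (by linarith [h2.2])
  have : C⁻¹ ≤ dv r u (u + ε) := inv_le_of_inv_le₀ h3.1 h3.2
  linarith

/-- `Ω² > 0` prevents `ν` from vanishing, and `ν` is continuous in `v` off the axis, so the sign
found near the axis persists. -/
theorem IsBVSolution.nu_neg (h : IsBVSolution φ r m) {u v : ℝ} (hu : 1 ≤ u) (huv : u < v) :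
    du r u v < 0 := by
  obtain ⟨ε, h1, h2⟩ := ((h.nu_neg_near_axis hu).and
    (Ioo_mem_nhdsGT (sub_pos.2 huv))).exists
  by_contra hcon
  have hcont := (h.nu_ac u (u + ε) v hu (by linarith [h2.1]) (by linarith [h2.2])).continuousOn
  rw [uIcc_of_le (by linarith [h2.2])] at hcont
  obtain ⟨w, hw, hw0⟩ := intermediate_value_Icc (by linarith [h2.2]) hcont
    ⟨h1.le, not_lt.1 hcon⟩
  exact h.nu_ne_zero hu (by linarith [hw.1, h2.1]) hw0

theorem IsBVSolution.one_sub_massRatio_pos (h : IsBVSolution φ r m) {u v : ℝ} (hu : 1 ≤ u)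
    (huv : u < v) : 0 < 1 - massRatio r m u v := by
  have h1 := h.omegaSq_pos u v hu huv
  have h2 : 0 < -4 * du r u v * dv r u v :=
    mul_pos (by linarith [h.nu_neg hu huv]) (h.lam_pos hu huv.le)
  unfold omegaSq at h1
  exact (div_pos_iff_of_pos_left h2).1 h1

theorem IsBVSolution.dv_m_nonneg (h : IsBVSolution φ r m) {u : ℝ} (hu : 1 ≤ u) :
    ∀ᵐ v, v ∈ Ioi u → 0 ≤ dv m u v := by
  filter_upwards [h.eq_dv_m u hu] with v hv hvu
  have h1 := h.lam_pos hu (le_of_lt hvu)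
  have h2 := h.one_sub_massRatio_pos hu hvu
  have h3 : 0 ≤ 2 * dv r u v * dv m u v := by rw [hv hvu]; positivity
  exact nonneg_of_mul_nonneg_right h3 (by positivity)

theorem IsBVSolution.m_mono_v (h : IsBVSolution φ r m) {u v₁ v₂ : ℝ} (hu : 1 ≤ u) (h₁ : u ≤ v₁)
    (h₂ : v₁ ≤ v₂) : m u v₁ ≤ m u v₂ := by
  refine AbsolutelyContinuousOnInterval.le_of_ae_deriv_nonneg (f := fun v => m u v) h₂
    ((h.m_ac_v u v₂ hu (h₁.trans h₂)).mono_Icc h₁ h₂ le_rfl) ?_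
  filter_upwards [h.dv_m_nonneg hu, h.ae_m_v hu] with v h3 h4 hv k hk
  have hv' : v ∈ Ioi u := h₁.trans_lt hv.1
  rw [hk.unique (h4 hv')]
  exact h3 hv'

theorem IsBVSolution.m_nonneg (h : IsBVSolution φ r m) {u v : ℝ} (hu : 1 ≤ u) (huv : u ≤ v) :
    0 ≤ m u v := by
  rw [← h.m_axis u hu]
  exact h.m_mono_v hu le_rfl huv

theorem IsBVSolution.m_anti_u (h : IsBVSolution φ r m) {u₁ u₂ v : ℝ} (hu : 1 ≤ u₁) (h₁ : u₁ ≤ u₂)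
    (h₂ : u₂ ≤ v) : m u₂ v ≤ m u₁ v := by
  have hv : 1 ≤ v := hu.trans (h₁.trans h₂)
  rcases h₁.eq_or_lt with rfl | h₁'
  · exact le_rfl
  have hv1 : 1 < v := (hu.trans_lt h₁').trans_le h₂
  have := AbsolutelyContinuousOnInterval.le_of_ae_deriv_nonneg (f := fun u => -m u v) h₁
    ((h.m_ac_u v hv).mono_Icc hu h₁ h₂).fun_neg ?_
  · simpa using this
  filter_upwards [h.eq_du_m v hv1, h.ae_m_u hv1] with u h3 h4 hu' k hk
  have hmem : u ∈ Ioo 1 v := ⟨hu.trans_lt hu'.1, hu'.2.trans_le h₂⟩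
  have h5 := h.nu_neg hmem.1.le hmem.2
  have h6 := h.one_sub_massRatio_pos hmem.1.le hmem.2
  have h7 : 0 ≤ 2 * du r u v * du m u v := by rw [h3 hmem]; positivity
  rw [hk.unique (h4 hmem).neg, Left.nonneg_neg_iff]
  by_contra hcon
  nlinarith [mul_neg_of_neg_of_pos h5 (not_le.1 hcon)]

theorem IsBVSolution.massRatio_nonneg (h : IsBVSolution φ r m) {u v : ℝ} (hu : 1 ≤ u)
    (huv : u < v) : 0 ≤ massRatio r m u v :=
  div_nonneg (by linarith [h.m_nonneg hu huv.le]) (h.r_pos u v hu huv).le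

/-- This sign makes `λ` decrease in `u` and `ν` decrease in `v`, so that both can serve as monotone
integrators in the wave equation. -/
theorem IsBVSolution.potential_nonpos (h : IsBVSolution φ r m) {u v : ℝ} (hu : 1 ≤ u)
    (huv : u < v) : potential r m u v ≤ 0 := by
  refine mul_nonpos_of_nonneg_of_nonpos (mul_nonneg (div_nonneg (h.massRatio_nonneg hu huv)
    (mul_nonneg (h.one_sub_massRatio_pos hu huv).le (h.r_pos u v hu huv).le))
    (h.lam_pos hu huv.le).le) (h.nu_neg hu huv).le

theorem IsBVSolution.r_mono_v (h : IsBVSolution φ r m) {u v₁ v₂ : ℝ} (hu : 1 ≤ u) (h₁ : u ≤ v₁)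
    (h₂ : v₁ ≤ v₂) : r u v₁ ≤ r u v₂ := by
  refine AbsolutelyContinuousOnInterval.le_of_ae_deriv_nonneg (f := fun v => r u v) h₂
    ((h.r_ac_v u v₂ hu (h₁.trans h₂)).mono_Icc h₁ h₂ le_rfl) ?_
  filter_upwards [h.ae_r_v hu] with v h4 hv k hk
  have hv' : v ∈ Ioi u := h₁.trans_lt hv.1
  rw [hk.unique (h4 hv')]
  exact (h.lam_pos hu (le_of_lt hv')).le

theorem IsBVSolution.r_nonneg (h : IsBVSolution φ r m) {u v : ℝ} (hu : 1 ≤ u) (huv : u ≤ v) :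
    0 ≤ r u v := by
  rw [← h.r_axis u hu]
  exact h.r_mono_v hu le_rfl huv

theorem IsBVSolution.r_anti_u (h : IsBVSolution φ r m) {u₁ u₂ v : ℝ} (hu : 1 ≤ u₁) (h₁ : u₁ ≤ u₂)
    (h₂ : u₂ ≤ v) : r u₂ v ≤ r u₁ v := by
  have hv : 1 ≤ v := hu.trans (h₁.trans h₂)
  rcases h₁.eq_or_lt with rfl | h₁'
  · exact le_rfl
  have hv1 : 1 < v := (hu.trans_lt h₁').trans_le h₂
  have := AbsolutelyContinuousOnInterval.le_of_ae_deriv_nonneg (f := fun u => -r u v) h₁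
    ((h.r_ac_u v hv).mono_Icc hu h₁ h₂).fun_neg ?_
  · simpa using this
  filter_upwards [h.ae_r_u hv1] with u h4 hu' k hk
  have hmem : u ∈ Ioo 1 v := ⟨hu.trans_lt hu'.1, hu'.2.trans_le h₂⟩
  rw [hk.unique (h4 hmem).neg]
  linarith [h.nu_neg hmem.1.le hmem.2]

theorem IsBVSolution.lam_anti (h : IsBVSolution φ r m) {u₁ u₂ v : ℝ} (hu : 1 ≤ u₁) (h₁ : u₁ ≤ u₂)
    (h₂ : u₂ < v) : dv r u₂ v ≤ dv r u₁ v := by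
  have hv1 : 1 < v := (hu.trans h₁).trans_lt h₂
  have := AbsolutelyContinuousOnInterval.le_of_ae_deriv_nonneg (f := fun u => -dv r u v) h₁
    ((h.lam_ac u₂ v (hu.trans h₁) h₂).mono_Icc hu h₁ le_rfl).fun_neg ?_
  · simpa using this
  filter_upwards [h.ae_lam_u hv1] with u h4 hu' k hk
  have hmem : u ∈ Ioo 1 v := ⟨hu.trans_lt hu'.1, hu'.2.trans h₂⟩
  rw [hk.unique (h4 hmem).neg]
  linarith [h.potential_nonpos hmem.1.le hmem.2]

theorem IsSolution.lam_initial (h : IsSolution φ r m) {v : ℝ} (hv : 1 ≤ v) : dv r 1 v = 1 / 2 := by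
  have h1 : HasDerivWithinAt (fun v' : ℝ => (v' - 1) / 2) (1 / 2) (Ioi v) v :=
    (((hasDerivAt_id v).sub_const 1).div_const 2).hasDerivWithinAt
  have h2 : HasDerivWithinAt (fun v' : ℝ => r 1 v') (1 / 2) (Ioi v) v := by
    refine h1.congr (fun x hx => ?_) ?_
    · linarith [h.r_initial x (hv.trans (le_of_lt hx))]
    · linarith [h.r_initial v hv]
  exact h2.derivWithin (uniqueDiffWithinAt_Ioi v)

theorem IsBVSolution.lam_le_half (h : IsBVSolution φ r m) {u v : ℝ} (hu : 1 ≤ u) (huv : u < v) :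
    dv r u v ≤ 1 / 2 := by
  rw [← h.lam_initial (hu.trans huv.le)]
  exact h.lam_anti le_rfl hu huv

theorem IsBVSolution.nu_anti (h : IsBVSolution φ r m) {u v₁ v₂ : ℝ} (hu : 1 ≤ u) (h₁ : u < v₁)
    (h₂ : v₁ ≤ v₂) : du r u v₂ ≤ du r u v₁ := by
  have := AbsolutelyContinuousOnInterval.le_of_ae_deriv_nonneg (f := fun v => -du r u v) h₂
    (h.nu_ac u v₁ v₂ hu h₁ h₂).fun_neg ?_
  · simpa using this
  filter_upwards [h.ae_nu_v hu] with v h4 hv k hk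
  have hv' : v ∈ Ioi u := h₁.trans hv.1
  rw [hk.unique (h4 hv').neg]
  linarith [h.potential_nonpos hu hv']

theorem IsBVSolution.r_sub_le (h : IsBVSolution φ r m) {u v₁ v₂ : ℝ} (hu : 1 ≤ u) (h₁ : u ≤ v₁)
    (h₂ : v₁ ≤ v₂) : r u v₂ - r u v₁ ≤ (v₂ - v₁) / 2 := by
  have := AbsolutelyContinuousOnInterval.le_of_ae_deriv_nonneg
    (f := fun v => (1 / 2) * v - r u v) h₂
    (((AbsolutelyContinuousOnInterval.id v₁ v₂).const_mul (1 / 2)).fun_sub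
      ((h.r_ac_v u v₂ hu (h₁.trans h₂)).mono_Icc h₁ h₂ le_rfl)) ?_
  · linarith
  filter_upwards [h.ae_r_v hu] with v h4 hv k hk
  have hv' : v ∈ Ioi u := h₁.trans_lt hv.1
  rw [hk.unique (((hasDerivAt_id v).const_mul (1 / 2)).sub (h4 hv'))]
  linarith [h.lam_le_half hu hv']

theorem IsBVSolution.r_le (h : IsBVSolution φ r m) {u v : ℝ} (hu : 1 ≤ u) (huv : u ≤ v) :
    r u v ≤ (v - u) / 2 := by
  have := h.r_sub_le hu le_rfl huv
  rwa [h.r_axis u hu, sub_zero] at this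

theorem IsBVSolution.le_r_sub (h : IsBVSolution φ r m) {u v₁ v₂ l : ℝ} (hu : 1 ≤ u)
    (h₁ : u ≤ v₁) (h₂ : v₁ ≤ v₂) (hl : ∀ v ∈ Ioo v₁ v₂, l ≤ dv r u v) :
    l * (v₂ - v₁) ≤ r u v₂ - r u v₁ := by
  have := AbsolutelyContinuousOnInterval.le_of_ae_deriv_nonneg
    (f := fun v => r u v - l * v) h₂
    (((h.r_ac_v u v₂ hu (h₁.trans h₂)).mono_Icc h₁ h₂ le_rfl).fun_sub
      ((AbsolutelyContinuousOnInterval.id v₁ v₂).const_mul l)) ?_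
  · linarith
  filter_upwards [h.ae_r_v hu] with v h4 hv k hk
  have hv' : v ∈ Ioi u := h₁.trans_lt hv.1
  rw [hk.unique ((h4 hv').sub ((hasDerivAt_id v).const_mul l))]
  linarith [hl v hv]

/-! ### Estimates where the mass ratio is at most one half -/

theorem IsBVSolution.neg_potential_eq (h : IsBVSolution φ r m) {u v : ℝ} (hu : 1 ≤ u)
    (huv : u < v) : -potential r m u v =
      2 * m u v / ((1 - massRatio r m u v) * r u v ^ 2) * dv r u v * (-du r u v) := by
  have h1 := (h.r_pos u v hu huv).ne'
  have h2 := (h.one_sub_massRatio_pos hu huv).ne'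
  unfold potential
  conv_lhs => enter [1, 1, 1, 1]; rw [massRatio]
  field_simp

theorem IsBVSolution.half_le_one_sub_massRatio (h : IsBVSolution φ r m) {u v : ℝ} (hu : 1 ≤ u)
    (huv : u < v) (h4 : 4 * m u v ≤ r u v) : 1 / 2 ≤ 1 - massRatio r m u v := by
  have h1 := h.r_pos u v hu huv
  have : massRatio r m u v ≤ 1 / 2 := by
    rw [massRatio, div_le_iff₀ h1]; linarith
  linarith

/-- Here `μ ≤ 1/2`. After division by `λ` or by `-ν` the bound is, up to sign, the `u`- or
`v`-derivative of `4 M / r`, so `log λ` and `log (-ν)` can be compared with `4 M / r`. -/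
theorem IsBVSolution.neg_potential_le (h : IsBVSolution φ r m) {u v M : ℝ} (hu : 1 ≤ u)
    (huv : u < v) (hM : m u v ≤ M) (h4 : 4 * M ≤ r u v) :
    -potential r m u v ≤ 4 * M / r u v ^ 2 * dv r u v * (-du r u v) := by
  have h1 := h.r_pos u v hu huv
  have h2 := h.half_le_one_sub_massRatio hu huv (by linarith)
  have h3 := h.nu_neg hu huv
  have h5 := h.lam_pos hu huv.le
  have h6 := h.m_nonneg hu huv.le
  rw [h.neg_potential_eq hu huv]
  have h7 : 2 * m u v / ((1 - massRatio r m u v) * r u v ^ 2) ≤ 4 * M / r u v ^ 2 := by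
    calc 2 * m u v / ((1 - massRatio r m u v) * r u v ^ 2)
        ≤ 2 * M / (1 / 2 * r u v ^ 2) := by gcongr; linarith
      _ = 4 * M / r u v ^ 2 := by ring
  exact mul_le_mul_of_nonneg_right (mul_le_mul_of_nonneg_right h7 h5.le) (by linarith)

/-- Away from the axis `log λ` varies little along incoming null curves. -/
theorem IsBVSolution.log_lam_sub_le (h : IsBVSolution φ r m) {u₁ u₂ v M : ℝ} (hu : 1 ≤ u₁)
    (h₁ : u₁ ≤ u₂) (h₂ : u₂ < v) (hM : m u₁ v ≤ M) (h4 : 4 * M ≤ r u₂ v) :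
    Real.log (dv r u₁ v) - Real.log (dv r u₂ v) ≤ 4 * M / r u₂ v := by
  have hv1 : 1 < v := (hu.trans h₁).trans_lt h₂
  have hM0 : 0 ≤ M := (h.m_nonneg hu (h₁.trans h₂.le)).trans hM
  have hpos : ∀ u ∈ uIcc u₁ u₂, 1 ≤ u ∧ u < v := by
    rw [uIcc_of_le h₁]
    exact fun u hu' => ⟨hu.trans hu'.1, hu'.2.trans_lt h₂⟩
  have hr := (h.r_ac_u v hv1.le).mono_Icc hu h₁ h₂.le
  have hl := (h.lam_ac u₂ v (hu.trans h₁) h₂).mono_Icc hu h₁ le_rfl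
  have := AbsolutelyContinuousOnInterval.le_of_ae_deriv_nonneg
    (f := fun u => Real.log (dv r u v) + 4 * M * (r u v)⁻¹) h₁
    ((hl.log_of_pos fun u hu' => h.lam_pos (hpos u hu').1 (hpos u hu').2.le).fun_add
      ((hr.inv_of_pos fun u hu' => h.r_pos u v (hpos u hu').1 (hpos u hu').2).const_mul (4 * M))) ?_
  · have h5 : 0 ≤ 4 * M * (r u₁ v)⁻¹ :=
      mul_nonneg (by linarith) (inv_nonneg.2 (h.r_nonneg hu (h₁.trans h₂.le)))
    rw [div_eq_mul_inv]
    linarith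
  filter_upwards [h.ae_lam_u hv1, h.ae_r_u hv1] with u h5 h6 hu' k hk
  have hmem : u ∈ Ioo 1 v := ⟨hu.trans_lt hu'.1, hu'.2.trans h₂⟩
  have hlp := h.lam_pos hmem.1.le hmem.2.le
  have hrp := h.r_pos u v hmem.1.le hmem.2
  have hrle : r u₂ v ≤ r u v := h.r_anti_u hmem.1.le hu'.2.le h₂.le
  have hmle : m u v ≤ M := (h.m_anti_u hu hu'.1.le hmem.2.le).trans hM
  have hp := h.neg_potential_le hmem.1.le hmem.2 hmle (h4.trans hrle)
  rw [hk.unique (((h5 hmem).log hlp.ne').add (((h6 hmem).inv hrp.ne').const_mul (4 * M)))]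
  have : -(4 * M / r u v ^ 2 * (-du r u v)) ≤ potential r m u v / dv r u v := by
    rw [le_div_iff₀ hlp]
    linarith
  calc (0 : ℝ) = -(4 * M / r u v ^ 2 * (-du r u v)) + 4 * M * (-du r u v / r u v ^ 2) := by ring
    _ ≤ _ := by linarith

/-- Away from the axis `-ν` grows by a bounded factor along outgoing null curves. -/
theorem IsBVSolution.neg_nu_le_exp_one_mul (h : IsBVSolution φ r m) {u v₁ v₂ M : ℝ} (hu : 1 ≤ u)
    (h₁ : u < v₁) (h₂ : v₁ ≤ v₂) (hM : m u v₂ ≤ M) (h4 : 4 * M ≤ r u v₁) :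
    -du r u v₂ ≤ Real.exp 1 * -du r u v₁ := by
  have hM0 : 0 ≤ M := (h.m_nonneg hu (h₁.le.trans h₂)).trans hM
  have hpos : ∀ v ∈ uIcc v₁ v₂, u < v := by
    rw [uIcc_of_le h₂]
    exact fun v hv => h₁.trans_le hv.1
  have hr := (h.r_ac_v u v₂ hu (h₁.le.trans h₂)).mono_Icc h₁.le h₂ le_rfl
  have hl := (h.nu_ac u v₁ v₂ hu h₁ h₂).fun_neg
  have := AbsolutelyContinuousOnInterval.le_of_ae_deriv_nonneg
    (f := fun v => -(4 * M * (r u v)⁻¹) - Real.log (-du r u v)) h₂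
    (((hr.inv_of_pos fun v hv => h.r_pos u v hu (hpos v hv)).const_mul (4 * M)).fun_neg.fun_sub
      (hl.log_of_pos fun v hv => neg_pos.2 (h.nu_neg hu (hpos v hv)))) ?_
  · have h5 : 4 * M * (r u v₁)⁻¹ ≤ 1 := by
      rw [← div_eq_mul_inv]
      exact div_le_one_of_le₀ h4 (h.r_nonneg hu h₁.le)
    have h6 : 0 ≤ 4 * M * (r u v₂)⁻¹ :=
      mul_nonneg (by linarith) (inv_nonneg.2 (h.r_nonneg hu (h₁.le.trans h₂)))
    have n1 := neg_pos.2 (h.nu_neg hu h₁)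
    have n2 := neg_pos.2 (h.nu_neg hu (h₁.trans_le h₂))
    rw [← Real.log_le_log_iff n2 (by positivity), Real.log_mul (Real.exp_pos 1).ne' n1.ne',
      Real.log_exp]
    linarith
  filter_upwards [h.ae_nu_v hu, h.ae_r_v hu] with v h5 h6 hv k hk
  have huv : u < v := h₁.trans hv.1
  have hnp := neg_pos.2 (h.nu_neg hu huv)
  have hrp := h.r_pos u v hu huv
  have hrle : r u v₁ ≤ r u v := h.r_mono_v hu h₁.le hv.1.le
  have hmle : m u v ≤ M := (h.m_mono_v hu huv.le hv.2.le).trans hM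
  have hp := h.neg_potential_le hu huv hmle (h4.trans hrle)
  rw [hk.unique ((((h6 huv).inv hrp.ne').const_mul (4 * M)).neg.sub
    ((h5 huv).neg.log hnp.ne'))]
  have : -potential r m u v / -du r u v ≤ 4 * M / r u v ^ 2 * dv r u v := by
    rw [div_le_iff₀ hnp]
    exact hp
  calc (0 : ℝ) = -(4 * M * (-dv r u v / r u v ^ 2)) - 4 * M / r u v ^ 2 * dv r u v := by ring
    _ ≤ _ := sub_le_sub_left this _

end SSESF

/-! ### Barrier argument, integrals of derivatives and variation bounds -/

theorem AbsolutelyContinuousOnInterval.nonpos_of_ae_deriv_nonpos {f : ℝ → ℝ} {a b : ℝ}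
    (hab : a ≤ b) (hf : AbsolutelyContinuousOnInterval f a b) (ha : f a ≤ 0)
    (h : ∀ᵐ x, x ∈ Ioo a b → 0 < f x → ∀ f', HasDerivAt f f' x → f' ≤ 0) : f b ≤ 0 := by
  have hcont := hf.continuousOn
  rw [uIcc_of_le hab] at hcont
  have hclosed : IsClosed (Icc a b ∩ f ⁻¹' Iic 0) :=
    hcont.preimage_isClosed_of_isClosed isClosed_Icc isClosed_Iic
  -- Beyond the last point `w` with `f w ≤ 0` the function is positive, so the derivative condition
  -- applies on all of `(w, b)`.
  obtain ⟨w, ⟨hw, hw0⟩, hmax⟩ := (isCompact_Icc.of_isClosed_subset hclosed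
    inter_subset_left).exists_isGreatest ⟨a, ⟨le_rfl, hab⟩, ha⟩
  have := AbsolutelyContinuousOnInterval.le_of_ae_deriv_nonneg (f := fun x => -f x) hw.2
    (hf.mono_Icc hw.1 hw.2 le_rfl).fun_neg ?_
  · have hw1 : f w ≤ 0 := hw0
    linarith
  filter_upwards [h] with x hx hxw k hk
  have hpos : 0 < f x := by
    by_contra hcon
    exact absurd (hmax ⟨⟨hw.1.trans hxw.1.le, hxw.2.le⟩, not_lt.1 hcon⟩) (not_le.2 hxw.1)
  have := hx ⟨hw.1.trans_lt hxw.1, hxw.2⟩ hpos (-k) (by simpa using hk.fun_neg)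
  linarith

theorem AbsolutelyContinuousOnInterval.lintegral_derivWithin_Ioi_eq {f : ℝ → ℝ} {a b : ℝ}
    (hab : a ≤ b) (hf : AbsolutelyContinuousOnInterval f a b)
    (h : ∀ x ∈ Ioc a b, 0 ≤ derivWithin f (Ioi x) x) :
    ∫⁻ x in Ioc a b, ENNReal.ofReal (derivWithin f (Ioi x) x) = ENNReal.ofReal (f b - f a) := by
  have hae : deriv f =ᵐ[volume.restrict (Ioc a b)] fun x => derivWithin f (Ioi x) x := by
    rw [EventuallyEq, ae_restrict_iff' measurableSet_Ioc]
    filter_upwards [hf.ae_hasDerivAt_derivWithin_Ioi] with x hx hxab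
    exact (hx (by rw [uIcc_of_le hab]; exact Ioc_subset_Icc_self hxab)).deriv
  have hint : Integrable (fun x => derivWithin f (Ioi x) x) (volume.restrict (Ioc a b)) :=
    ((intervalIntegrable_iff_integrableOn_Ioc_of_le hab).1 hf.intervalIntegrable_deriv).congr hae
  rw [← hf.integral_deriv_eq_sub, intervalIntegral.integral_of_le hab, integral_congr_ae hae,
    ofReal_integral_eq_lintegral_ofReal hint]
  rw [EventuallyLE, ae_restrict_iff' measurableSet_Ioc]
  exact Eventually.of_forall h

theorem abs_sub_le_of_eVariationOn_le {f : ℝ → ℝ} {s : Set ℝ} {δ x y : ℝ} (hδ : 0 ≤ δ)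
    (h : eVariationOn f s ≤ ENNReal.ofReal δ) (hx : x ∈ s) (hy : y ∈ s) : |f x - f y| ≤ δ := by
  have h1 := (eVariationOn.edist_le f hx hy).trans h
  rw [edist_dist, ENNReal.ofReal_le_ofReal_iff hδ] at h1
  exact h1

namespace SSESF

variable {φ r m : ℝ → ℝ → ℝ}

/-! ### Averaging and the mass ratio -/

/-- `r φ` is an integral of `∂_v (r φ)`. -/
theorem IsBVSolution.abs_rphi_sub_le (h : IsBVSolution φ r m) {u v₁ v₂ : ℝ} {g : ℝ → ℝ}
    (hu : 1 ≤ u) (h₁ : u ≤ v₁) (h₂ : v₁ ≤ v₂) (hg : AbsolutelyContinuousOnInterval g v₁ v₂)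
    (hfg : ∀ᵐ v, v ∈ Ioo v₁ v₂ → ∀ g', HasDerivAt g g' v → |dv (r * φ) u v| ≤ g') :
    |r u v₂ * φ u v₂ - r u v₁ * φ u v₁| ≤ g v₂ - g v₁ := by
  refine AbsolutelyContinuousOnInterval.abs_sub_le_of_ae_abs_deriv_le
    (f := fun v => (r * φ) u v) h₂
    ((h.rphi_ac_v hu (h₁.trans h₂)).mono_Icc h₁ h₂ le_rfl) hg ?_
  filter_upwards [hfg, h.ae_rphi_v hu] with v h3 h4 hv k g' hk hg'
  rw [hk.unique (h4 (h₁.trans_lt hv.1))]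
  exact h3 hv g' hg'

/-- Because `r` vanishes on the axis, `φ` is the average of `∂_v (r φ) / λ` along `C_u` with weight
`λ dv`. -/
theorem IsBVSolution.abs_phi_le (h : IsBVSolution φ r m) {u v H : ℝ} (hu : 1 ≤ u) (huv : u < v)
    (hH : ∀ s ∈ Ioo u v, |dv (r * φ) u s| ≤ H * dv r u s) : |φ u v| ≤ H := by
  have h1 := h.abs_rphi_sub_le hu le_rfl huv.le ((h.r_ac_v u v hu huv.le).const_mul H) ?_
  · have hr := h.r_pos u v hu huv
    rw [h.r_axis u hu, zero_mul, sub_zero, mul_zero, sub_zero, abs_mul, abs_of_pos hr,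
      mul_comm] at h1
    exact le_of_mul_le_mul_right h1 hr
  filter_upwards [h.ae_r_v hu] with s h4 hs g' hg'
  rw [hg'.unique ((h4 hs.1).const_mul H)]
  exact hH s hs

theorem IsBVSolution.ae_r_mul_dv_phi (h : IsBVSolution φ r m) {u : ℝ} (hu : 1 ≤ u) :
    ∀ᵐ v, v ∈ Ioi u → r u v * dv φ u v = dv (r * φ) u v - dv r u v * φ u v := by
  filter_upwards [h.ae_r_v hu, h.ae_phi_v hu, h.ae_rphi_v hu] with v h1 h2 h3 hv
  have := (h3 hv).unique ((h1 hv).mul (h2 hv))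
  linarith

/-- The mass equation in terms of `r ∂_v φ = ∂_v (r φ) - λ φ`. -/
theorem IsBVSolution.ae_two_mul_dv_m (h : IsBVSolution φ r m) {u : ℝ} (hu : 1 ≤ u) :
    ∀ᵐ v, v ∈ Ioi u → 2 * dv m u v =
      (1 - massRatio r m u v) * (dv r u v * (dv (r * φ) u v / dv r u v - φ u v) ^ 2) := by
  filter_upwards [h.ae_r_mul_dv_phi hu, h.eq_dv_m u hu] with v h1 h2 hv
  have hl := (h.lam_pos hu (le_of_lt hv)).ne'
  have h3 : dv r u v * (2 * dv m u v) =
      (1 - massRatio r m u v) * (r u v * dv φ u v) ^ 2 := by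
    rw [mul_pow, ← mul_assoc (1 - massRatio r m u v), ← h2 hv]; ring
  rw [h1 hv] at h3
  apply mul_left_cancel₀ hl
  rw [h3]
  field_simp

/-- Barrier for `2 m - κ r`: where it is positive, `1 - μ < 1 - κ`, so `2 ∂_v m ≤ (1 - κ) λ (2 H)²`.
The value of `κ` is the one for which this equals `κ λ = κ ∂_v r`. -/
theorem IsBVSolution.inv_le_one_sub_massRatio (h : IsBVSolution φ r m) {u v H : ℝ} (hu : 1 ≤ u) (huv : u < v)
    (hH : ∀ s ∈ Ioo u v, |dv (r * φ) u s| ≤ H * dv r u s) :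
    (1 + 4 * H ^ 2)⁻¹ ≤ 1 - massRatio r m u v := by
  have hN : 0 < 1 + 4 * H ^ 2 := by positivity
  set κ := 4 * H ^ 2 / (1 + 4 * H ^ 2) with hκ
  have hκ' : (1 + 4 * H ^ 2)⁻¹ = 1 - κ := by rw [hκ]; field_simp; ring
  have hκ4 : (1 - κ) * (4 * H ^ 2) = κ := by rw [hκ]; field_simp; ring
  have key := AbsolutelyContinuousOnInterval.nonpos_of_ae_deriv_nonpos
    (f := fun s => 2 * m u s - κ * r u s) huv.le
    (((h.m_ac_v u v hu huv.le).const_mul 2).fun_sub ((h.r_ac_v u v hu huv.le).const_mul κ))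
    (by rw [h.r_axis u hu, h.m_axis u hu]; simp) ?_
  · rw [hκ']
    have : massRatio r m u v ≤ κ := by
      rw [massRatio, div_le_iff₀ (h.r_pos u v hu huv)]; linarith
    linarith
  filter_upwards [h.ae_r_v hu, h.ae_m_v hu, h.ae_two_mul_dv_m hu] with s h1 h2 h3 hs hpos k hk
  rw [hk.unique (((h2 hs.1).const_mul 2).sub ((h1 hs.1).const_mul κ)), h3 hs.1]
  have hr := h.r_pos u s hu hs.1
  have hl := h.lam_pos hu hs.1.le
  have hμ : κ < massRatio r m u s := by
    rw [massRatio, lt_div_iff₀ hr]; linarith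
  have hφ : |φ u s| ≤ H :=
    h.abs_phi_le hu hs.1 fun t ht => hH t ⟨ht.1, ht.2.trans hs.2⟩
  have hg : |dv (r * φ) u s / dv r u s| ≤ H := by
    rw [abs_div, abs_of_pos hl, div_le_iff₀ hl]; exact hH s hs
  have hsq : (dv (r * φ) u s / dv r u s - φ u s) ^ 2 ≤ 4 * H ^ 2 := by
    have h5 : |dv (r * φ) u s / dv r u s - φ u s| ≤ 2 * H :=
      (abs_sub _ _).trans (by linarith)
    calc _ = |dv (r * φ) u s / dv r u s - φ u s| ^ 2 := (sq_abs _).symm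
      _ ≤ (2 * H) ^ 2 := by gcongr
      _ = 4 * H ^ 2 := by ring
  have h6 := h.one_sub_massRatio_pos hu hs.1
  have : (1 - massRatio r m u s) * (dv r u s * (dv (r * φ) u s / dv r u s - φ u s) ^ 2) ≤
      (1 - κ) * (dv r u s * (4 * H ^ 2)) := by
    have h7 : 0 ≤ 1 - κ := by linarith
    gcongr
  calc _ ≤ (1 - κ) * (dv r u s * (4 * H ^ 2)) - κ * dv r u s := by linarith
    _ = ((1 - κ) * (4 * H ^ 2) - κ) * dv r u s := by ring
    _ = 0 := by rw [hκ4]; ring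
    _ ≤ 0 := le_rfl

theorem IsBVSolution.exists_one_sub_massRatio_ge (h : IsBVSolution φ r m) {u v₀ : ℝ} (hu : 1 ≤ u)
    (huv : u ≤ v₀) : ∃ c : ℝ, 0 < c ∧ ∀ v, u < v → v ≤ v₀ → c ≤ 1 - massRatio r m u v := by
  obtain ⟨C, hC⟩ := (h.bv_on u v₀ hu huv).lam_inv_bdd
  obtain ⟨D, hD⟩ := (h.bv_on u v₀ hu huv).dv_rphi_bv
  have hDu := hD u ⟨le_rfl, huv⟩
  rw [← ENNReal.ofReal_coe_nnreal] at hDu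
  set F : ℝ := |dv (r * φ) u u| + D
  have hF : ∀ s ∈ Icc u v₀, |dv (r * φ) u s| ≤ F := by
    intro s hs
    have := abs_sub_le_of_eVariationOn_le D.coe_nonneg hDu hs ⟨le_rfl, huv⟩
    have := abs_sub_abs_le_abs_sub (dv (r * φ) u s) (dv (r * φ) u u)
    change _ ≤ |dv (r * φ) u u| + (D : ℝ)
    linarith
  refine ⟨(1 + 4 * (F * C) ^ 2)⁻¹, by positivity, fun v h₁ h₂ =>
    h.inv_le_one_sub_massRatio hu h₁ fun s hs => ?_⟩
  have hs' : s ∈ Icc u v₀ := ⟨hs.1.le, hs.2.le.trans h₂⟩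
  have hl := hC u s le_rfl hs'.1 hs'.2
  have h3 : 1 ≤ C * dv r u s := by
    rw [inv_le_iff_one_le_mul₀ hl.1] at hl
    exact hl.2
  have hF0 : 0 ≤ F := by positivity
  calc |dv (r * φ) u s| ≤ F * 1 := by linarith [hF s hs']
    _ ≤ F * (C * dv r u s) := by gcongr
    _ = F * C * dv r u s := by ring

/-! ### Outgoing null curves reach infinity -/

theorem IsLocallyBVScattering.exists_mass_bound (h : IsLocallyBVScattering φ r m) :
    ∃ M : ℝ → ℝ, (∀ u v, 1 ≤ u → u ≤ v → m u v ≤ M u) ∧ Tendsto M atTop (𝓝 0) := by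
  obtain ⟨M, hM, hM0⟩ := h.final_bondi_mass
  refine ⟨M, fun u v hu huv => ge_of_tendsto (hM u hu) ?_, hM0⟩
  filter_upwards [eventually_ge_atTop v] with w hw
  exact h.m_mono_v hu huv hw

/-- If `r` stayed below `ρ`, the affine length of `C_u` would be finite: up to `v₁`, `Ω²` is bounded
since `1 - μ ≥ c`; beyond `v₁` it is at most a constant times `λ`, whose integral is at most `ρ`. -/
theorem IsLocallyBVScattering.exists_r_ge_of_far (h : IsLocallyBVScattering φ r m) {u v₁ M : ℝ}
    (hu : 1 ≤ u) (huv : u < v₁) (hM : ∀ v, u ≤ v → m u v ≤ M) (h4 : 4 * M ≤ r u v₁) (ρ : ℝ) :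
    ∃ v, v₁ ≤ v ∧ ρ ≤ r u v := by
  by_contra! hcon
  obtain ⟨c, hc, hcμ⟩ := h.exists_one_sub_massRatio_ge hu huv.le
  set N := -du r u v₁ with hN
  have hN0 : 0 < N := neg_pos.2 (h.nu_neg hu huv)
  have near : ∫⁻ v in Ioc u v₁, ENNReal.ofReal (omegaSq r m u v) < ∞ := by
    calc ∫⁻ v in Ioc u v₁, ENNReal.ofReal (omegaSq r m u v)
        ≤ ∫⁻ _ in Ioc u v₁, ENNReal.ofReal (4 * N * (1 / 2) / c) := by
          refine setLIntegral_mono' measurableSet_Ioc fun v hv => ENNReal.ofReal_le_ofReal ?_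
          have h1 := h.lam_le_half hu hv.1
          have h2 := h.lam_pos hu hv.1.le
          have h3 := h.nu_anti hu hv.1 hv.2
          have h5 := hcμ v hv.1 hv.2
          have h6 := h.nu_neg hu hv.1
          have h7 : -4 * du r u v ≤ 4 * N := by linarith
          rw [omegaSq]
          gcongr
      _ < ∞ := by
          rw [lintegral_const]
          exact ENNReal.mul_lt_top ENNReal.ofReal_lt_top (by simp)
  have far : ∫⁻ v in Ioi v₁, ENNReal.ofReal (omegaSq r m u v) < ∞ := by
    have hlam : ∫⁻ v in Ioi v₁, ENNReal.ofReal (dv r u v) ≤ ENNReal.ofReal ρ := by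
      have hU : Ioi v₁ = ⋃ n : ℕ, Ioc v₁ (v₁ + n) := by
        ext x
        simp only [mem_Ioi, mem_iUnion, mem_Ioc]
        refine ⟨fun hx => ?_, fun ⟨n, hn⟩ => hn.1⟩
        obtain ⟨n, hn⟩ := exists_nat_ge (x - v₁)
        exact ⟨n, hx, by linarith⟩
      rw [hU, setLIntegral_iUnion_of_directed]
      · refine iSup_le fun n => ?_
        have hn : v₁ ≤ v₁ + n := by linarith [n.cast_nonneg (α := ℝ)]
        have h1 := ((h.r_ac_v u (v₁ + n) hu (huv.le.trans hn)).mono_Icc huv.le hn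
          le_rfl).lintegral_derivWithin_Ioi_eq hn
          fun x hx => (h.lam_pos hu (huv.le.trans hx.1.le)).le
        refine h1.le.trans (ENNReal.ofReal_le_ofReal ?_)
        linarith [hcon _ hn, h.r_nonneg hu huv.le]
      · refine Monotone.directed_le fun a b hab => Ioc_subset_Ioc_right ?_
        gcongr
    calc ∫⁻ v in Ioi v₁, ENNReal.ofReal (omegaSq r m u v)
        ≤ ∫⁻ v in Ioi v₁, ENNReal.ofReal (8 * (Real.exp 1 * N)) * ENNReal.ofReal (dv r u v) := by
          refine setLIntegral_mono' measurableSet_Ioi fun v hv => ?_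
          rw [mem_Ioi] at hv
          have huv' : u < v := huv.trans hv
          rw [← ENNReal.ofReal_mul (by positivity)]
          refine ENNReal.ofReal_le_ofReal ?_
          have h1 := h.lam_pos hu huv'.le
          have h2 := h.neg_nu_le_exp_one_mul hu huv hv.le (hM v huv'.le) h4
          have h3 := h.nu_neg hu huv'
          have h5 := h.half_le_one_sub_massRatio hu huv'
            (by linarith [hM v huv'.le, h.r_mono_v hu huv.le hv.le])
          rw [omegaSq, div_le_iff₀ (by linarith)]
          calc -4 * du r u v * dv r u v = 4 * (-du r u v) * dv r u v := by ring
            _ ≤ 4 * (Real.exp 1 * N) * dv r u v := by gcongr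
            _ = 8 * (Real.exp 1 * N) * dv r u v * (1 / 2) := by ring
            _ ≤ _ := by gcongr
      _ = ENNReal.ofReal (8 * (Real.exp 1 * N)) * ∫⁻ v in Ioi v₁, ENNReal.ofReal (dv r u v) :=
          lintegral_const_mul' _ _ ENNReal.ofReal_ne_top
      _ < ∞ := ENNReal.mul_lt_top ENNReal.ofReal_lt_top (hlam.trans_lt ENNReal.ofReal_lt_top)
  have htot := h.outgoing_complete u hu
  rw [← Ioc_union_Ioi_eq_Ioi huv.le] at htot
  have := (lintegral_union_le (fun v => ENNReal.ofReal (omegaSq r m u v)) (μ := volume)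
    (Ioc u v₁) (Ioi v₁)).trans_lt (ENNReal.add_lt_top.2 ⟨near, far⟩)
  exact this.ne htot

/-- If `r` stayed below `R`, the variation bound would hold on all of `C_u`, keeping `λ` above a
positive constant `l`; then `r` would reach `R` by `v = u + R / l`. -/
theorem IsBVSolution.exists_r_ge_of_log_lam (h : IsBVSolution φ r m) {u R δ : ℝ} (hu : 1 ≤ u)
    (hR : 0 < R) (hδ : 0 ≤ δ)
    (hTV : eVariationOn (fun v => Real.log (dv r u v)) {v | u ≤ v ∧ r u v ≤ R} ≤
      ENNReal.ofReal δ) : ∃ v, u < v ∧ R ≤ r u v := by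
  by_contra! hcon
  have haxis : u ∈ {v | u ≤ v ∧ r u v ≤ R} := ⟨le_rfl, by rw [h.r_axis u hu]; exact hR.le⟩
  set l := dv r u u * Real.exp (-δ) with hl
  have hl0 : 0 < l := mul_pos (h.lam_pos hu le_rfl) (Real.exp_pos _)
  have hlam : ∀ v, u < v → l ≤ dv r u v := by
    intro v hv
    have h1 := (abs_le.1 (abs_sub_le_of_eVariationOn_le hδ hTV
      (show v ∈ {v | u ≤ v ∧ r u v ≤ R} from ⟨hv.le, (hcon v hv).le⟩) haxis)).1
    rw [← Real.log_le_log_iff hl0 (h.lam_pos hu hv.le), hl,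
      Real.log_mul (h.lam_pos hu le_rfl).ne' (Real.exp_pos _).ne', Real.log_exp]
    linarith
  have hv : u < u + R / l := by linarith [div_pos hR hl0]
  have h1 := h.le_r_sub hu le_rfl hv.le fun v hv => hlam v hv.1
  rw [h.r_axis u hu, add_sub_cancel_left, mul_div_cancel₀ _ hl0.ne'] at h1
  linarith [hcon _ hv]

/-- On a late curve `C_w` the mass is small against `R`, so reaching `R` suffices to go on to any
radius. Earlier curves inherit this because `r` decreases in `u`. -/
theorem IsLocallyBVScattering.exists_r_ge (h : IsLocallyBVScattering φ r m) {u : ℝ} (hu : 1 ≤ u)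
    (ρ : ℝ) : ∃ v, u < v ∧ ρ ≤ r u v := by
  obtain ⟨R, hR, -, hTV⟩ := h.scattering
  obtain ⟨M, hM, hM0⟩ := h.exists_mass_bound
  obtain ⟨w, hw1, hw2, hw3⟩ := ((ENNReal.tendsto_nhds_zero.1 hTV (ENNReal.ofReal 1)
    (by simp)).and ((hM0.eventually (ge_mem_nhds (show (0 : ℝ) < R / 4 by positivity))).and
    (eventually_ge_atTop u))).exists
  have hw : 1 ≤ w := hu.trans hw3
  obtain ⟨v₁, hv₁, hRv₁⟩ := h.exists_r_ge_of_log_lam hw hR zero_le_one hw1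
  obtain ⟨v, hv, hρ⟩ := h.exists_r_ge_of_far hw hv₁ (fun v hv => hM w v hw hv) (by linarith) ρ
  exact ⟨v, hw3.trans_lt (hv₁.trans_le hv), hρ.trans (h.r_anti_u hu hw3 (hv₁.le.trans hv))⟩

theorem IsLocallyBVScattering.exists_r_eq (h : IsLocallyBVScattering φ r m) {u v R : ℝ}
    (hu : 1 ≤ u) (huv : u ≤ v) (hR : r u v ≤ R) : ∃ w, v ≤ w ∧ r u w = R := by
  obtain ⟨v₁, hv₁, hRv₁⟩ := h.exists_r_ge hu R
  have hcont := (h.r_ac_v u (max v v₁) hu (huv.trans (le_max_left _ _))).continuousOn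
  rw [uIcc_of_le (huv.trans (le_max_left _ _))] at hcont
  obtain ⟨w, hw, hw'⟩ := intermediate_value_Icc (le_max_left v v₁)
    (hcont.mono (Icc_subset_Icc_left huv))
    ⟨hR, hRv₁.trans (h.r_mono_v hu hv₁.le (le_max_right _ _))⟩
  exact ⟨w, hw.1, hw'⟩

/-! ### Uniform bounds for `λ` -/

/-- A rephrasing of `exists_r_ge` which is uniform on `[1, U]`. -/
theorem IsLocallyBVScattering.exists_forall_r_ge (h : IsLocallyBVScattering φ r m) {U : ℝ}
    (hU : 1 ≤ U) (ρ : ℝ) :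
    ∃ V, U < V ∧ ∀ u v, 1 ≤ u → u ≤ U → V ≤ v → ρ ≤ r u v := by
  obtain ⟨V, hV, hρ⟩ := h.exists_r_ge hU ρ
  exact ⟨V, hV, fun u v hu huU hVv => (hρ.trans (h.r_mono_v hU hV.le hVv)).trans
    (h.r_anti_u hu huU (hV.le.trans hVv))⟩

theorem IsLocallyBVScattering.exists_forall_log_lam_ge_of_le (h : IsLocallyBVScattering φ r m)
    {U ε : ℝ} (hU : 1 ≤ U) (hε : 0 < ε) :
    ∃ V, U < V ∧ ∀ u v, 1 ≤ u → u ≤ U → V ≤ v →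
      Real.log (1 / 2) - ε ≤ Real.log (dv r u v) := by
  obtain ⟨M, hM, -⟩ := h.exists_mass_bound
  have hM1 : 0 ≤ M 1 := (h.m_nonneg le_rfl le_rfl).trans (hM 1 1 le_rfl le_rfl)
  obtain ⟨V, hV, hr⟩ := h.exists_forall_r_ge hU (max (4 * M 1) (4 * M 1 / ε))
  refine ⟨V, hV, fun u v hu huU hVv => ?_⟩
  have huv : u < v := huU.trans_lt (hV.trans_le hVv)
  have hr' := hr u v hu huU hVv
  have h1 := h.log_lam_sub_le le_rfl hu huv (hM 1 v le_rfl (hu.trans huv.le))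
    ((le_max_left _ _).trans hr')
  rw [h.lam_initial (hu.trans huv.le)] at h1
  have h2 : 4 * M 1 / r u v ≤ ε := by
    rw [div_le_iff₀ (h.r_pos u v hu huv)]
    have := (le_max_right (4 * M 1) _).trans hr'
    rw [div_le_iff₀ hε] at this
    linarith
  linarith

/-- `λ` tends to `1 / 2` uniformly on `C_u` as `u → ∞`. -/
theorem IsLocallyBVScattering.exists_forall_log_lam_ge (h : IsLocallyBVScattering φ r m)
    {ε : ℝ} (hε : 0 < ε) :
    ∃ U, 1 ≤ U ∧ ∀ u v, U ≤ u → u ≤ v → Real.log (1 / 2) - ε ≤ Real.log (dv r u v) := by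
  obtain ⟨R, hR, -, hTV⟩ := h.scattering
  obtain ⟨M, hM, hM0⟩ := h.exists_mass_bound
  -- One third each for the drop of `log λ` from `C₁` to `C_U` at large `v`, for the drop from `C_U`
  -- to `C_u` in `r ≥ R`, and for its oscillation on `C_u` in `r ≤ R`.
  have hε3 : 0 < ε / 3 := by positivity
  have hcond := (ENNReal.tendsto_nhds_zero.1 hTV (ENNReal.ofReal (ε / 3)) (by simpa)).and
    ((hM0.eventually (ge_mem_nhds (show (0 : ℝ) < R / 4 * min 1 (ε / 3) by positivity))).and
    (eventually_ge_atTop 1))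
  obtain ⟨U₁, hU₁⟩ := eventually_atTop.1 hcond
  have hU := hU₁ (max U₁ 1) (le_max_left _ _)
  set U := max U₁ 1
  obtain ⟨V, hV, hlog⟩ := h.exists_forall_log_lam_ge_of_le hU.2.2 hε3
  have hM4 : 4 * M U ≤ R * min 1 (ε / 3) := by linarith [hU.2.1]
  have far : ∀ u v, V ≤ u → u < v → R ≤ r u v →
      Real.log (1 / 2) - 2 * (ε / 3) ≤ Real.log (dv r u v) := by
    intro u v hu huv hRr
    have hUu : U ≤ u := hV.le.trans hu
    have h1 := hlog U v hU.2.2 le_rfl (hu.trans huv.le)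
    have h2 := h.log_lam_sub_le hU.2.2 hUu huv (hM U v hU.2.2 (hUu.trans huv.le))
      (by nlinarith [min_le_left (1 : ℝ) (ε / 3)])
    have h3 : 4 * M U / r u v ≤ ε / 3 := by
      rw [div_le_iff₀ (hR.trans_le hRr)]
      calc 4 * M U ≤ R * min 1 (ε / 3) := hM4
        _ ≤ r u v * (ε / 3) := 
            mul_le_mul hRr (min_le_right _ _) (by positivity) (hR.le.trans hRr)
        _ = _ := by ring
    linarith
  refine ⟨V, hU.2.2.trans hV.le, fun u v hu huv => ?_⟩
  have hu1 : 1 ≤ u := hU.2.2.trans (hV.le.trans hu)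
  rcases le_or_gt (r u v) R with hle | hgt
  · obtain ⟨w, hw, hwR⟩ := h.exists_r_eq hu1 huv hle
    have huw : u < w := by
      refine lt_of_le_of_ne (huv.trans hw) fun heq => ?_
      rw [← heq, h.r_axis u hu1] at hwR
      exact hR.ne hwR
    have h1 := far u w hu huw hwR.ge
    have h2 := (abs_le.1 (abs_sub_le_of_eVariationOn_le hε3.le
      (hU₁ u ((le_max_left U₁ 1).trans (hV.le.trans hu))).1
      (show v ∈ {v | u ≤ v ∧ r u v ≤ R} from ⟨huv, hle⟩)
      (show w ∈ {v | u ≤ v ∧ r u v ≤ R} from ⟨huw.le, hwR.le⟩))).1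
    linarith
  · have huv' : u < v := by
      refine lt_of_le_of_ne huv fun heq => ?_
      rw [← heq, h.r_axis u hu1] at hgt
      exact hR.not_gt hgt
    linarith [far u v hu huv' hgt.le]

theorem IsLocallyBVScattering.exists_forall_lam_ge (h : IsLocallyBVScattering φ r m) {l : ℝ}
    (hl0 : 0 < l) (hl : l < 1 / 2) : ∃ U, 1 ≤ U ∧ ∀ u v, U ≤ u → u ≤ v → l ≤ dv r u v := by
  obtain ⟨U, hU, hlam⟩ := h.exists_forall_log_lam_ge
    (sub_pos.2 (Real.log_lt_log hl0 hl))
  refine ⟨U, hU, fun u v hu huv => ?_⟩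
  have := hlam u v hu huv
  rw [sub_sub_cancel] at this
  exact (Real.log_le_log_iff hl0 (h.lam_pos (hU.trans hu) huv)).1 this

theorem IsLocallyBVScattering.exists_lam_ge (h : IsLocallyBVScattering φ r m) :
    ∃ l : ℝ, 0 < l ∧ ∀ u v, 1 ≤ u → u ≤ v → l ≤ dv r u v := by
  obtain ⟨U, hU, h1⟩ := h.exists_forall_lam_ge (l := 1 / 4) (by norm_num) (by norm_num)
  obtain ⟨V, hV, h2⟩ := h.exists_forall_log_lam_ge_of_le hU one_pos
  obtain ⟨C, hC⟩ := (h.bv_on 1 V le_rfl (hU.trans hV.le)).lam_inv_bdd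
  have hC0 : 0 < C := by
    have := hC 1 1 le_rfl le_rfl (hU.trans hV.le)
    exact (inv_pos.2 this.1).trans_le this.2
  refine ⟨min (1 / 4) (min (1 / 2 * Real.exp (-1)) C⁻¹), by positivity, fun u v hu huv => ?_⟩
  rcases le_or_gt U u with hUu | hUu
  · exact (min_le_left _ _).trans (h1 u v hUu huv)
  refine (min_le_right _ _).trans ?_
  rcases le_or_gt V v with hVv | hVv
  · refine (min_le_left _ _).trans ?_
    have h3 := h2 u v hu hUu.le hVv
    rw [← Real.log_le_log_iff (by positivity) (h.lam_pos hu huv),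
      Real.log_mul (by norm_num) (Real.exp_pos _).ne', Real.log_exp]
    linarith
  · refine (min_le_right _ _).trans ?_
    have h3 := hC u v hu huv hVv.le
    exact inv_le_of_inv_le₀ h3.1 h3.2

end SSESF

/-! ### Power functions used as comparison primitives -/

theorem hasDerivAt_neg_rpow_one_sub_div {p s : ℝ} (hp : 1 < p) (hs : 0 < s) :
    HasDerivAt (fun s : ℝ => -(s ^ (1 - p) / (p - 1))) (s ^ (-p)) s := by
  have h1 := ((Real.hasDerivAt_rpow_const (p := 1 - p) (Or.inl hs.ne')).div_const (p - 1)).fun_neg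
  have h2 : p - 1 ≠ 0 := by linarith
  have h3 : -((1 - p) * s ^ (1 - p - 1) / (p - 1)) = s ^ (-p) := by
    rw [show 1 - p - 1 = -p by ring]
    field_simp
    ring
  rwa [h3] at h1

theorem absolutelyContinuousOnInterval_rpow {a b : ℝ} (p : ℝ) (ha : 0 < a) (hab : a ≤ b) :
    AbsolutelyContinuousOnInterval (fun s : ℝ => s ^ p) a b :=
  AbsolutelyContinuousOnInterval.contDiffOn_comp_of_pos (F := fun s : ℝ => s ^ p)
    (fun _ hx => (Real.contDiffAt_rpow_const_of_ne (ne_of_gt hx)).contDiffWithinAt)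
    (AbsolutelyContinuousOnInterval.id a b)
    fun x hx => by rw [uIcc_of_le hab] at hx; exact ha.trans_le hx.1

namespace SSESF

variable {φ r m : ℝ → ℝ → ℝ}

/-! ### Integrating the wave equation -/

theorem IsBVSolution.abs_dv_rphi_sub_le (h : IsBVSolution φ r m) {u₁ u₂ v : ℝ} {g : ℝ → ℝ}
    (hu : 1 ≤ u₁) (h₁ : u₁ ≤ u₂) (h₂ : u₂ < v) (hg : AbsolutelyContinuousOnInterval g u₁ u₂)
    (hfg : ∀ᵐ u, u ∈ Ioo u₁ u₂ → ∀ g', HasDerivAt g g' u → -potential r m u v * |φ u v| ≤ g') :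
    |dv (r * φ) u₂ v - dv (r * φ) u₁ v| ≤ g u₂ - g u₁ := by
  have hv1 : 1 < v := (hu.trans h₁).trans_lt h₂
  refine AbsolutelyContinuousOnInterval.abs_sub_le_of_ae_abs_deriv_le
    (f := fun u => dv (r * φ) u v) h₁
    ((h.dv_rphi_ac u₂ v (hu.trans h₁) h₂).mono_Icc hu h₁ le_rfl) hg ?_
  filter_upwards [hfg, h.ae_dv_rphi_u hv1] with u h3 h4 hu' k g' hk hg'
  have hmem : u ∈ Ioo 1 v := ⟨hu.trans_lt hu'.1, hu'.2.trans h₂⟩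
  rw [hk.unique (h4 hmem), abs_mul, abs_of_nonpos (h.potential_nonpos hmem.1.le hmem.2)]
  exact h3 hu' g' hg'

/-- Both `λ` and `∂_v (r φ)` are driven in `u` by the same potential, so `-X λ` is a comparison
function. -/
theorem IsBVSolution.abs_dv_rphi_sub_le_lam (h : IsBVSolution φ r m) {u₁ u₂ v X : ℝ}
    (hu : 1 ≤ u₁) (h₁ : u₁ ≤ u₂) (h₂ : u₂ < v) (hX : ∀ u ∈ Ioo u₁ u₂, |φ u v| ≤ X) :
    |dv (r * φ) u₂ v - dv (r * φ) u₁ v| ≤ X * (dv r u₁ v - dv r u₂ v) := by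
  have hv1 : 1 < v := (hu.trans h₁).trans_lt h₂
  have := h.abs_dv_rphi_sub_le hu h₁ h₂ (g := fun u => -X * dv r u v)
    (((h.lam_ac u₂ v (hu.trans h₁) h₂).mono_Icc hu h₁ le_rfl).const_mul (-X)) ?_
  · linarith
  filter_upwards [h.ae_lam_u hv1] with u h4 hu' g' hg'
  have hmem : u ∈ Ioo 1 v := ⟨hu.trans_lt hu'.1, hu'.2.trans h₂⟩
  rw [hg'.unique ((h4 hmem).const_mul (-X))]
  nlinarith [h.potential_nonpos hmem.1.le hmem.2, hX u hu']

theorem IsBVSolution.abs_rphi_sub_le_of_rpow (h : IsBVSolution φ r m) {u v₁ v₂ A B p : ℝ}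
    (hu : 1 ≤ u) (h₁ : u ≤ v₁) (h₂ : v₁ ≤ v₂) (hp : 1 < p) (hA : 0 ≤ A) (hB : 0 ≤ B)
    (hf : ∀ s ∈ Ioo v₁ v₂, |dv (r * φ) u s| ≤ A * s ^ (-p) + B * s ^ (-3 : ℝ)) :
    |r u v₂ * φ u v₂ - r u v₁ * φ u v₁| ≤
      A * (v₁ ^ (1 - p) / (p - 1)) + B * (v₁ ^ (-2 : ℝ) / 2) := by
  have h0 : 0 < v₁ := by linarith
  have hp1 : 0 < p - 1 := by linarith
  have ac : ∀ q : ℝ,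
      AbsolutelyContinuousOnInterval (fun s : ℝ => -(s ^ (1 - q) / (q - 1))) v₁ v₂ := by
    intro q
    have := ((absolutelyContinuousOnInterval_rpow (1 - q) h0 h₂).const_mul (q - 1)⁻¹).fun_neg
    simpa only [div_eq_inv_mul] using this
  have key := h.abs_rphi_sub_le hu h₁ h₂
    (((ac p).const_mul A).fun_add ((ac 3).const_mul B)) ?_
  · have e1 : 0 ≤ A * (v₂ ^ (1 - p) / (p - 1)) := by
      have : 0 < v₂ := by linarith
      positivity
    have e2 : 0 ≤ B * (v₂ ^ (1 - 3 : ℝ) / (3 - 1)) := by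
      have : 0 < v₂ := by linarith
      have : (0 : ℝ) < 3 - 1 := by norm_num
      positivity
    have e3 : v₁ ^ (1 - 3 : ℝ) / (3 - 1) = v₁ ^ (-2 : ℝ) / 2 := by norm_num
    rw [e3] at key
    linarith
  refine Eventually.of_forall fun s hs g' hg' => ?_
  have hs0 : 0 < s := h0.trans hs.1
  rw [hg'.unique (((hasDerivAt_neg_rpow_one_sub_div hp hs0).const_mul A).add
    ((hasDerivAt_neg_rpow_one_sub_div (by norm_num : (1 : ℝ) < 3) hs0).const_mul B))]
  exact hf s hs

/-- Far from the axis the right-hand side of the wave equation is of order `v⁻³`. -/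
theorem IsBVSolution.neg_potential_mul_abs_phi_le (h : IsBVSolution φ r m) {u v l M K : ℝ}
    (hu : 1 ≤ u) (huv : 2 * u ≤ v) (hl : 0 < l) (hr : l * (v - u) ≤ r u v) (hM : m u v ≤ M)
    (hMv : 8 * M ≤ l * v) (hK : -du r u v ≤ K) :
    -potential r m u v * |φ u v| ≤
      16 * M * K / l ^ 3 * v ^ (-3 : ℝ) * |r u v * φ u v| := by
  have huv' : u < v := by linarith
  have hv : 0 < v := by linarith
  -- From `v - u ≥ v / 2`; together with `8 M ≤ l v` this yields `4 M ≤ r`.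
  have hr' : l * v / 2 ≤ r u v := by nlinarith
  have hr0 := h.r_pos u v hu huv'
  have hM0 := (h.m_nonneg hu huv'.le).trans hM
  have hlp := h.lam_pos hu huv'.le
  have hnu := h.nu_neg hu huv'
  have h1 := h.neg_potential_le hu huv' hM (by linarith)
  have hK0 : 0 ≤ K := by linarith
  have h2 : 4 * M / r u v ^ 2 * dv r u v * (-du r u v) ≤ 4 * M / r u v ^ 2 * (1 / 2) * K := by
    have := h.lam_le_half hu huv'
    gcongr
    linarith
  have h3 : 4 * M / r u v ^ 2 * (1 / 2) * K * |φ u v| =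
      2 * M * K / r u v ^ 3 * |r u v * φ u v| := by
    rw [abs_mul, abs_of_pos hr0]
    field_simp
    ring
  calc -potential r m u v * |φ u v| ≤ 4 * M / r u v ^ 2 * (1 / 2) * K * |φ u v| := by
        gcongr
        exact h1.trans h2
    _ = 2 * M * K / r u v ^ 3 * |r u v * φ u v| := h3
    _ ≤ 2 * M * K / (l * v / 2) ^ 3 * |r u v * φ u v| := by gcongr
    _ = _ := by
        rw [Real.rpow_neg hv.le, show (3 : ℝ) = ((3 : ℕ) : ℝ) by norm_num, Real.rpow_natCast]
        field_simp
        ring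

/-! ### Bounds for bounded `u` -/

theorem exists_abs_dv_rphi_initial_le (h : IsSolution φ r m) {ω ω' : ℝ} (hω0 : 1 < ω)
    (hω : ω ≤ ω') (hflat : IsAsymptoticallyFlatBV φ r ω') :
    ∃ I : ℝ, 0 < I ∧ ∀ v, 1 ≤ v → |dv (r * φ) 1 v| ≤ I * v ^ (-ω) := by
  obtain ⟨-, I, hI, hb⟩ := hflat
  refine ⟨I * 2 ^ ω, by positivity, fun v hv => ?_⟩
  have hr : 1 + r 1 v = (v + 1) / 2 := by linarith [h.r_initial v hv]
  have h1 := hb v hv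
  rw [hr] at h1
  have h2 : (v / 2) ^ ω ≤ ((v + 1) / 2) ^ ω' :=
    calc (v / 2) ^ ω ≤ ((v + 1) / 2) ^ ω := by gcongr; linarith
      _ ≤ ((v + 1) / 2) ^ ω' := Real.rpow_le_rpow_of_exponent_le (by linarith) hω
  have h3 : (v / 2) ^ ω * |dv (r * φ) 1 v| ≤ I := le_trans (by gcongr) h1
  have hv0 : 0 < v := by linarith
  rw [Real.div_rpow hv0.le (by norm_num)] at h3
  rw [Real.rpow_neg hv0.le]
  have p1 : 0 < v ^ ω := by positivity
  have p2 : (0 : ℝ) < 2 ^ ω := by positivity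
  rw [← div_eq_mul_inv, le_div_iff₀ p1]
  rw [div_mul_eq_mul_div, div_le_iff₀ p2] at h3
  linarith

theorem IsLocallyBVScattering.exists_neg_nu_le_of_le (h : IsLocallyBVScattering φ r m) {U : ℝ}
    (hU : 1 ≤ U) : ∃ K : ℝ, 0 < K ∧ ∀ u v, 1 ≤ u → u ≤ U → u < v → -du r u v ≤ K := by
  obtain ⟨M, hM, -⟩ := h.exists_mass_bound
  obtain ⟨V, hV, hr⟩ := h.exists_forall_r_ge hU (4 * M 1)
  obtain ⟨C, hC⟩ := (h.bv_on 1 V le_rfl (hU.trans hV.le)).neg_nu_bdd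
  have hC0 : 0 < C :=
    (neg_pos.2 (h.nu_neg le_rfl (hU.trans_lt hV))).trans_le
      (hC 1 V le_rfl (hU.trans_lt hV) le_rfl)
  have he : 1 ≤ Real.exp 1 := Real.one_le_exp zero_le_one
  refine ⟨Real.exp 1 * C, by positivity, fun u v hu huU huv => ?_⟩
  rcases le_or_gt v V with hv | hv
  · have := hC u v hu huv hv
    nlinarith
  · have huV : u < V := huU.trans_lt hV
    have h1 := h.neg_nu_le_exp_one_mul hu huV hv.le
      ((h.m_anti_u le_rfl hu huv.le).trans (hM 1 v le_rfl (hu.trans huv.le)))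
      (hr u V hu huU le_rfl)
    refine h1.trans ?_
    gcongr
    exact hC u V hu huV le_rfl

theorem IsBVSolution.exists_abs_phi_le_of_le (h : IsBVSolution φ r m) {V : ℝ} (hV : 1 ≤ V) :
    ∃ C : ℝ, 0 ≤ C ∧ ∀ u v, 1 ≤ u → u ≤ v → v ≤ V → |φ u v| ≤ C := by
  obtain ⟨C₁, hC₁⟩ := (h.bv_on 1 V le_rfl hV).phi_bv_v
  obtain ⟨C₂, hC₂⟩ := (h.bv_on 1 V le_rfl hV).phi_bv_u
  refine ⟨|φ 1 1| + C₁ + C₂, by positivity, fun u v hu huv hv => ?_⟩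
  have h1 := hC₁ 1 ⟨le_rfl, hV⟩
  have h2 := hC₂ v ⟨hu.trans huv, hv⟩
  rw [← ENNReal.ofReal_coe_nnreal] at h1 h2
  have h3 := abs_sub_le_of_eVariationOn_le C₁.coe_nonneg h1
    (⟨hu.trans huv, hv⟩ : v ∈ Icc 1 V) (⟨le_rfl, hV⟩ : (1 : ℝ) ∈ Icc 1 V)
  have h4 := abs_sub_le_of_eVariationOn_le C₂.coe_nonneg h2
    (⟨hu, huv⟩ : u ∈ Icc 1 v) (⟨le_rfl, hu.trans huv⟩ : (1 : ℝ) ∈ Icc 1 v)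
  have h5 := abs_sub_abs_le_abs_sub (φ u v) (φ 1 v)
  have h6 := abs_sub_abs_le_abs_sub (φ 1 v) (φ 1 1)
  linarith

/-- For bounded `u`, the right-hand side of the wave equation is of order `v⁻³` times `r φ`. -/
theorem IsLocallyBVScattering.exists_potential_far_le (h : IsLocallyBVScattering φ r m) {U : ℝ}
    (hU : 1 ≤ U) : ∃ V C : ℝ, 2 * U ≤ V ∧ 0 ≤ C ∧ ∀ u v, 1 ≤ u → u ≤ U → V ≤ v →
      -potential r m u v * |φ u v| ≤ C * v ^ (-3 : ℝ) * |r u v * φ u v| := by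
  obtain ⟨M, hM, -⟩ := h.exists_mass_bound
  obtain ⟨l, hl, hlam⟩ := h.exists_lam_ge
  obtain ⟨K, hK, hnu⟩ := h.exists_neg_nu_le_of_le hU
  have hM1 : 0 ≤ M 1 := (h.m_nonneg le_rfl le_rfl).trans (hM 1 1 le_rfl le_rfl)
  refine ⟨max (2 * U) (8 * M 1 / l), 16 * M 1 * K / l ^ 3, le_max_left _ _, by positivity,
    fun u v hu huU hv => ?_⟩
  have h1 : 2 * U ≤ v := (le_max_left _ _).trans hv
  have h2 : 8 * M 1 ≤ l * v := by
    have := (le_max_right _ _).trans hv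
    rwa [div_le_iff₀' hl] at this
  have huv : u < v := by linarith
  have h3 := h.le_r_sub hu le_rfl huv.le fun s hs => hlam u s hu hs.1.le
  rw [h.r_axis u hu, sub_zero] at h3
  exact h.neg_potential_mul_abs_phi_le hu (by linarith) hl h3
    ((h.m_anti_u le_rfl hu huv.le).trans (hM 1 v le_rfl (hu.trans huv.le))) h2
    (hnu u v hu huU huv)

theorem IsBVSolution.abs_dv_rphi_le_of_far (h : IsBVSolution φ r m) {U V C X u v : ℝ} (hU : 1 ≤ U)
    (hUV : 2 * U ≤ V) (hC : 0 ≤ C) (hX0 : 0 ≤ X)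
    (hpot : ∀ u v, 1 ≤ u → u ≤ U → V ≤ v →
      -potential r m u v * |φ u v| ≤ C * v ^ (-3 : ℝ) * |r u v * φ u v|)
    (hX : ∀ u', 1 ≤ u' → u' ≤ U → |r u' v * φ u' v| ≤ X) (hu : 1 ≤ u) (huU : u ≤ U)
    (hv : V ≤ v) :
    |dv (r * φ) u v| ≤ |dv (r * φ) 1 v| + C * U * X * v ^ (-3 : ℝ) := by
  have hv0 : 0 < v := by linarith
  have key := h.abs_dv_rphi_sub_le le_rfl hu (show u < v by linarith)
    ((AbsolutelyContinuousOnInterval.id 1 u).const_mul (C * v ^ (-3 : ℝ) * X)) ?_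
  · have h1 := abs_sub_abs_le_abs_sub (dv (r * φ) u v) (dv (r * φ) 1 v)
    have hp : 0 ≤ C * v ^ (-3 : ℝ) * X := by positivity
    have h2 : C * v ^ (-3 : ℝ) * X * u ≤ C * v ^ (-3 : ℝ) * X * U := by gcongr
    linarith
  refine Eventually.of_forall fun u' hu' g' hg' => ?_
  rw [hg'.unique ((hasDerivAt_id u').const_mul _), mul_one]
  refine (hpot u' v hu'.1.le (hu'.2.le.trans huU) hv).trans ?_
  have := hX u' hu'.1.le (hu'.2.le.trans huU)
  gcongr

/-- For `v ≥ V`, `r φ` is its value at `V` plus the integral of `∂_v (r φ)`, and the latter is the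
data plus a term of order `v⁻³ sup |r φ|`. For large `V` the last contribution is absorbed. The
cutoff `v ≤ W` only makes the supremum finite and does not enter the bound. -/
theorem IsLocallyBVScattering.exists_abs_rphi_le_of_le (h : IsLocallyBVScattering φ r m)
    {ω I U : ℝ} (hω : 1 < ω) (hI : 0 ≤ I) (hinit : ∀ v, 1 ≤ v → |dv (r * φ) 1 v| ≤ I * v ^ (-ω))
    (hU : 1 ≤ U) :
    ∃ C : ℝ, 0 ≤ C ∧ ∀ u v, 1 ≤ u → u ≤ U → u ≤ v → |r u v * φ u v| ≤ C := by
  have compact_bound : ∀ V, 1 ≤ V → ∃ D : ℝ, 0 ≤ D ∧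
      ∀ u v, 1 ≤ u → u ≤ v → v ≤ V → |r u v * φ u v| ≤ D := by
    intro V hV
    obtain ⟨Cφ, hCφ0, hCφ⟩ := h.exists_abs_phi_le_of_le hV
    refine ⟨V * Cφ, by positivity, fun u v hu huv hv => ?_⟩
    have hr : r u v ≤ V := by linarith [h.r_le hu huv]
    rw [abs_mul, abs_of_nonneg (h.r_nonneg hu huv)]
    exact mul_le_mul hr (hCφ u v hu huv hv) (abs_nonneg _) (by linarith)
  obtain ⟨V₀, C, hUV₀, hC, hpot⟩ := h.exists_potential_far_le hU
  -- With `V ≥ C U` and `V ≥ 1`, `C U V⁻² ≤ 1`, so the absorbed term carries a factor at most `1/2`.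
  set V := max V₀ (C * U) with hV
  have hUV : 2 * U ≤ V := hUV₀.trans (le_max_left _ _)
  have hV1 : 1 ≤ V := by linarith
  obtain ⟨D, hD0, hD⟩ := compact_bound V hV1
  have hω1 : 0 < ω - 1 := by linarith
  set B := D + I / (ω - 1) with hB
  have hB0 : 0 ≤ B := by positivity
  have far : ∀ W, V ≤ W → ∀ p : {p : ℝ × ℝ // (1 ≤ p.1 ∧ p.1 ≤ U) ∧ V ≤ p.2 ∧ p.2 ≤ W},
      |r p.1.1 p.1.2 * φ p.1.1 p.1.2| ≤ 2 * B := by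
    intro W hW
    refine le_two_mul_of_improvable ?_ ?_
    · obtain ⟨D', -, hD'⟩ := compact_bound W (hV1.trans hW)
      refine ⟨D', ?_⟩
      rintro _ ⟨p, rfl⟩
      exact hD' _ _ p.2.1.1 (by linarith [p.2.1.2, p.2.2.1]) p.2.2.2
    · rintro X hX ⟨⟨u, v⟩, ⟨hu, huU⟩, hv, hvW⟩
      dsimp only at hu huU hv hvW ⊢
      have hX0 : 0 ≤ X := (abs_nonneg _).trans (hX ⟨⟨u, v⟩, ⟨hu, huU⟩, hv, hvW⟩)
      have huV : u ≤ V := by linarith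
      have h1 := h.abs_rphi_sub_le_of_rpow hu huV hv hω hI
        (show 0 ≤ C * U * X by positivity) (fun s hs => by
          refine (h.abs_dv_rphi_le_of_far hU hUV hC hX0
            (fun u v hu huU hv => hpot u v hu huU ((le_max_left _ _).trans hv))
            (fun u' hu' hu'U => hX ⟨⟨u', s⟩, ⟨hu', hu'U⟩, hs.1.le, hs.2.le.trans hvW⟩)
            hu huU hs.1.le).trans ?_
          gcongr
          exact hinit s (hV1.trans hs.1.le))
      have h2 := hD u V hu huV le_rfl
      have h3 := abs_sub_abs_le_abs_sub (r u v * φ u v) (r u V * φ u V)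
      have h4 : I * (V ^ (1 - ω) / (ω - 1)) ≤ I / (ω - 1) := by
        rw [mul_div_assoc', div_le_div_iff_of_pos_right hω1]
        exact mul_le_of_le_one_right hI (Real.rpow_le_one_of_one_le_of_nonpos hV1 (by linarith))
      have h5 : C * U * X * (V ^ (-2 : ℝ) / 2) ≤ X / 2 := by
        have h6 : C * U * V ^ (-2 : ℝ) ≤ 1 := by
          rw [Real.rpow_neg (by linarith), Real.rpow_two, ← div_eq_mul_inv,
            div_le_one (by positivity)]
          have : C * U ≤ V := le_max_right _ _
          nlinarith
        nlinarith
      linarith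
  refine ⟨D + 2 * B, by positivity, fun u v hu huU huv => ?_⟩
  rcases le_or_gt v V with hv | hv
  · linarith [hD u v hu huv hv]
  · linarith [far v hv.le ⟨⟨u, v⟩, ⟨hu, huU⟩, hv.le, le_rfl⟩]

/-- The decay rate of `∂_v (r φ)` in `v` persists for bounded `u`. -/
theorem IsLocallyBVScattering.exists_abs_dv_rphi_le_of_le (h : IsLocallyBVScattering φ r m)
    {ω I U : ℝ} (hω : 1 < ω) (hω3 : ω ≤ 3) (hI : 0 ≤ I)
    (hinit : ∀ v, 1 ≤ v → |dv (r * φ) 1 v| ≤ I * v ^ (-ω)) (hU : 1 ≤ U) :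
    ∃ C : ℝ, 0 ≤ C ∧ ∀ u v, 1 ≤ u → u ≤ U → u < v → |dv (r * φ) u v| ≤ C * v ^ (-ω) := by
  obtain ⟨X, hX0, hX⟩ := h.exists_abs_rphi_le_of_le hω hI hinit hU
  obtain ⟨V, C, hUV, hC, hpot⟩ := h.exists_potential_far_le hU
  have hV1 : 1 ≤ V := by linarith
  obtain ⟨D, hD0, hD⟩ := h.exists_abs_phi_le_of_le hV1
  refine ⟨I + C * U * X + D * V ^ ω, by positivity, fun u v hu huU huv => ?_⟩
  have hv1 : 1 < v := hu.trans_lt huv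
  have hv0 : 0 < v := by linarith
  have hp : 0 < v ^ (-ω) := by positivity
  have hi := hinit v hv1.le
  rcases le_or_gt V v with hv | hv
  · have h1 := h.abs_dv_rphi_le_of_far hU hUV hC hX0 hpot
      (fun u' hu' hu'U => hX u' v hu' hu'U (by linarith)) hu huU hv
    have h2 : v ^ (-3 : ℝ) ≤ v ^ (-ω) := Real.rpow_le_rpow_of_exponent_le hv1.le (by linarith)
    have h3 : C * U * X * v ^ (-3 : ℝ) ≤ C * U * X * v ^ (-ω) := by gcongr
    have h4 : 0 ≤ D * V ^ ω * v ^ (-ω) := by positivity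
    linarith
  · have h1 := h.abs_dv_rphi_sub_le_lam le_rfl hu huv
      fun u' hu' => hD u' v hu'.1.le (hu'.2.le.trans huv.le) hv.le
    have h2 := abs_sub_abs_le_abs_sub (dv (r * φ) u v) (dv (r * φ) 1 v)
    rw [h.lam_initial hv1.le] at h1
    have h3 : D * (1 / 2 - dv r u v) ≤ D * 1 := by
      gcongr
      linarith [h.lam_pos hu huv.le]
    have h4 : 1 ≤ V ^ ω * v ^ (-ω) := by
      rw [Real.rpow_neg hv0.le, ← div_eq_mul_inv, one_le_div (by positivity)]
      gcongr
    have h5 : D * 1 ≤ D * (V ^ ω * v ^ (-ω)) := by gcongr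
    have h6 : 0 ≤ C * U * X * v ^ (-ω) := by positivity
    linarith

theorem IsBVSolution.abs_phi_le_div (h : IsBVSolution φ r m) {u v l X : ℝ} (hu : 1 ≤ u)
    (huv : u < v) (hl : 0 < l) (hX : 0 ≤ X) (hlam : ∀ u v, 1 ≤ u → u ≤ v → l ≤ dv r u v)
    (hf : ∀ s ∈ Ioo u v, |dv (r * φ) u s| ≤ X) : |φ u v| ≤ X / l :=
  h.abs_phi_le hu huv fun s hs => (hf s hs).trans (by
    calc X = X / l * l := by field_simp
      _ ≤ X / l * dv r u s := by gcongr; exact hlam u s hu hs.1.le)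

/-- After `U₁` the drop of `λ` is at most `l / 2`, while averaging gives `|φ| ≤ X / l`; hence `∂_v
(r φ)` changes by at most `X / 2`. Restricting to `u ≤ U` only ensures a finite supremum. -/
theorem IsLocallyBVScattering.exists_abs_dv_rphi_le (h : IsLocallyBVScattering φ r m)
    {ω I : ℝ} (hω : 1 < ω) (hω3 : ω ≤ 3) (hI : 0 ≤ I)
    (hinit : ∀ v, 1 ≤ v → |dv (r * φ) 1 v| ≤ I * v ^ (-ω)) :
    ∃ F : ℝ, 0 ≤ F ∧ ∀ u v, 1 ≤ u → u < v → |dv (r * φ) u v| ≤ F := by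
  obtain ⟨l, hl, hlam⟩ := h.exists_lam_ge
  have hl2 : l ≤ 1 / 2 := (hlam 1 2 le_rfl (by norm_num)).trans
    (h.lam_le_half le_rfl (by norm_num))
  obtain ⟨U₁, hU₁, hlam₁⟩ := h.exists_forall_lam_ge (l := 1 / 2 - l / 2) (by linarith)
    (by linarith)
  have bound : ∀ U, 1 ≤ U → ∃ C : ℝ, 0 ≤ C ∧
      ∀ u v, 1 ≤ u → u ≤ U → u < v → |dv (r * φ) u v| ≤ C := by
    intro U hU
    obtain ⟨C, hC, hCf⟩ := h.exists_abs_dv_rphi_le_of_le hω hω3 hI hinit hU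
    refine ⟨C, hC, fun u v hu huU huv => (hCf u v hu huU huv).trans ?_⟩
    exact mul_le_of_le_one_right hC
      (Real.rpow_le_one_of_one_le_of_nonpos (hu.trans huv.le) (by linarith))
  obtain ⟨C, hC, hCf⟩ := bound U₁ hU₁
  have late : ∀ U, ∀ p : {p : ℝ × ℝ // (U₁ ≤ p.1 ∧ p.1 ≤ U) ∧ p.1 < p.2},
      |dv (r * φ) p.1.1 p.1.2| ≤ 2 * C := by
    intro U
    refine le_two_mul_of_improvable ?_ ?_
    · obtain ⟨D, -, hD⟩ := bound (max U 1) (le_max_right _ _)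
      refine ⟨D, ?_⟩
      rintro _ ⟨p, rfl⟩
      exact hD _ _ (hU₁.trans p.2.1.1) (p.2.1.2.trans (le_max_left _ _)) p.2.2
    · rintro X hX ⟨⟨u, v⟩, ⟨hu, huU⟩, huv⟩
      dsimp only at hu huU huv ⊢
      have hX0 : 0 ≤ X := (abs_nonneg _).trans (hX ⟨⟨u, v⟩, ⟨hu, huU⟩, huv⟩)
      have h1 := h.abs_dv_rphi_sub_le_lam hU₁ hu huv (X := X / l) fun u' hu' =>
        h.abs_phi_le_div (hU₁.trans hu'.1.le) (hu'.2.trans huv) hl hX0 hlam fun s hs =>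
          hX ⟨⟨u', s⟩, ⟨hu'.1.le, hu'.2.le.trans huU⟩, hs.1⟩
      have h2 := abs_sub_abs_le_abs_sub (dv (r * φ) u v) (dv (r * φ) U₁ v)
      have h3 := hCf U₁ v hU₁ le_rfl (hu.trans_lt huv)
      have h4 : X / l * (dv r U₁ v - dv r u v) ≤ X / l * (l / 2) := by
        gcongr
        linarith [h.lam_le_half hU₁ (hu.trans_lt huv), hlam₁ u v hu huv.le]
      have h5 : X / l * (l / 2) = X / 2 := by field_simp
      linarith
  refine ⟨2 * C, by positivity, fun u v hu huv => ?_⟩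
  rcases le_or_gt u U₁ with hle | hgt
  · linarith [hCf u v hu hle huv]
  · exact late u ⟨⟨u, v⟩, ⟨hgt.le, le_rfl⟩, huv⟩

end SSESF

/-! ### Variation functions and the variation of a reciprocal -/

theorem exists_variation_function {f : ℝ → ℝ} {a b δ : ℝ} (hδ : 0 ≤ δ)
    (h : eVariationOn f (Icc a b) ≤ ENNReal.ofReal δ) :
    ∃ V : ℝ → ℝ, (∀ x ∈ Icc a b, 0 ≤ V x ∧ V x ≤ δ) ∧
      ∀ s t, a ≤ s → s ≤ t → t ≤ b → |f t - f s| ≤ V t - V s := by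
  have hfin : ∀ x ∈ Icc a b, eVariationOn f (Icc a x) ≤ ENNReal.ofReal δ := fun x hx =>
    (eVariationOn.mono f (Icc_subset_Icc_right hx.2)).trans h
  refine ⟨fun x => (eVariationOn f (Icc a x)).toReal, fun x hx => ⟨ENNReal.toReal_nonneg,
    ENNReal.toReal_le_of_le_ofReal hδ (hfin x hx)⟩, fun s t hs hst ht => ?_⟩
  have hadd := eVariationOn.Icc_add_Icc f (s := univ) hs hst (mem_univ s)
  simp only [univ_inter] at hadd
  have h1 : eVariationOn f (Icc a s) ≠ ∞ :=
    ((hfin s ⟨hs, hst.trans ht⟩).trans_lt ENNReal.ofReal_lt_top).ne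
  have h2 : eVariationOn f (Icc s t) ≠ ∞ :=
    (((eVariationOn.mono f (Icc_subset_Icc hs ht)).trans h).trans_lt ENNReal.ofReal_lt_top).ne
  have h3 := eVariationOn.edist_le f (right_mem_Icc.2 hst) (left_mem_Icc.2 hst)
  rw [edist_dist] at h3
  have h4 := (ENNReal.ofReal_le_iff_le_toReal h2).1 h3
  dsimp only
  rw [← hadd, ENNReal.toReal_add h1 h2, add_sub_cancel_left]
  exact h4

/-- Converts variation of `log λ` into variation of `1 / λ`, by `1 - 1/x ≤ log x`. -/
theorem abs_inv_sub_inv_le {a b l : ℝ} (hl : 0 < l) (ha : l ≤ a) (hb : l ≤ b) :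
    |a⁻¹ - b⁻¹| ≤ l⁻¹ * |Real.log a - Real.log b| := by
  wlog hab : a ≤ b generalizing a b
  · rw [abs_sub_comm, abs_sub_comm (Real.log a)]
    exact this hb ha (le_of_not_ge hab)
  have ha0 : 0 < a := hl.trans_le ha
  have hb0 : 0 < b := hl.trans_le hb
  have h1 := Real.one_sub_inv_le_log_of_pos (div_pos hb0 ha0)
  rw [Real.log_div hb0.ne' ha0.ne', inv_div] at h1
  have h2 := Real.log_le_log ha0 hab
  rw [abs_of_nonneg (sub_nonneg.2 (inv_anti₀ ha0 hab)), abs_sub_comm,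
    abs_of_nonneg (sub_nonneg.2 h2)]
  calc a⁻¹ - b⁻¹ = a⁻¹ * (1 - a / b) := by field_simp
    _ ≤ a⁻¹ * (Real.log b - Real.log a) := by gcongr
    _ ≤ l⁻¹ * (Real.log b - Real.log a) := by
        have : 0 ≤ Real.log b - Real.log a := sub_nonneg.2 h2
        gcongr

namespace SSESF

variable {φ r m : ℝ → ℝ → ℝ}

/-! ### A uniform bound for `ν` -/

/-- A control function `T` for the oscillation of `∂_v (r φ) / λ`, which bounds the total variation
of its average `φ`. -/
theorem exists_oscillation_control {u v₀ F l δ : ℝ} (hl : 0 < l) (hδ : 0 ≤ δ) (hF0 : 0 ≤ F)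
    (hlam : ∀ v, u ≤ v → l ≤ dv r u v) (hF : ∀ v, u < v → |dv (r * φ) u v| ≤ F)
    (hTVf : eVariationOn (fun v => dv (r * φ) u v) (Icc u v₀) ≤ ENNReal.ofReal δ)
    (hTVl : eVariationOn (fun v => Real.log (dv r u v)) (Icc u v₀) ≤ ENNReal.ofReal δ) :
    ∃ T : ℝ → ℝ, MonotoneOn T (Icc u v₀) ∧
      (∀ x ∈ Icc u v₀, 0 ≤ T x ∧ T x ≤ l⁻¹ * δ + F * l⁻¹ * δ) ∧
      ∀ s t, u < s → s ≤ t → t ≤ v₀ →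
        |dv (r * φ) u t / dv r u t - dv (r * φ) u s / dv r u s| ≤ T t - T s := by
  obtain ⟨V, hV, hVf⟩ := exists_variation_function hδ hTVf
  obtain ⟨W, hW, hWl⟩ := exists_variation_function hδ hTVl
  have hinc : ∀ s t, u ≤ s → s ≤ t → t ≤ v₀ →
      0 ≤ V t - V s ∧ 0 ≤ W t - W s := fun s t h1 h2 h3 =>
    ⟨(abs_nonneg _).trans (hVf s t h1 h2 h3), (abs_nonneg _).trans (hWl s t h1 h2 h3)⟩
  -- Product rule for `∂_v (r φ) · λ⁻¹`: the variation of each factor times a bound for the other.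
  refine ⟨fun x => l⁻¹ * V x + F * l⁻¹ * W x, ?_, ?_, ?_⟩
  · intro s hs t ht hst
    have := hinc s t hs.1 hst ht.2
    have h1 : V s ≤ V t := by linarith
    have h2 : W s ≤ W t := by linarith
    dsimp only
    gcongr
  · intro x hx
    have h1 := hV x hx
    have h2 := hW x hx
    obtain ⟨h3, h4⟩ := h1
    obtain ⟨h5, h6⟩ := h2
    dsimp only
    exact ⟨by positivity, by gcongr⟩
  · intro s t hs hst ht
    have hlt := hlam t (hs.le.trans hst)
    have hls := hlam s hs.le
    have e : dv (r * φ) u t / dv r u t - dv (r * φ) u s / dv r u s =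
        (dv (r * φ) u t - dv (r * φ) u s) * (dv r u t)⁻¹ +
          dv (r * φ) u s * ((dv r u t)⁻¹ - (dv r u s)⁻¹) := by
      rw [div_eq_mul_inv, div_eq_mul_inv]; ring
    have h1 : |(dv (r * φ) u t - dv (r * φ) u s) * (dv r u t)⁻¹| ≤ (V t - V s) * l⁻¹ := by
      rw [abs_mul, abs_of_pos (inv_pos.2 (hl.trans_le hlt))]
      exact mul_le_mul (hVf s t hs.le hst ht) (inv_anti₀ hl hlt)
        (inv_pos.2 (hl.trans_le hlt)).le (hinc s t hs.le hst ht).1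
    have h2 : |dv (r * φ) u s * ((dv r u t)⁻¹ - (dv r u s)⁻¹)| ≤ F * (l⁻¹ * (W t - W s)) := by
      rw [abs_mul]
      refine mul_le_mul (hF s hs) ((abs_inv_sub_inv_le hl hlt hls).trans ?_) (abs_nonneg _) hF0
      gcongr
      exact hWl s t hs.le hst ht
    rw [e]
    refine (abs_add_le _ _).trans ?_
    dsimp only
    linarith

theorem IsBVSolution.intervalIntegrable_lam_mul (h : IsBVSolution φ r m) {u v₀ : ℝ} {T : ℝ → ℝ}
    (hu : 1 ≤ u) (huv : u ≤ v₀) (hT : MonotoneOn T (Icc u v₀)) :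
    IntervalIntegrable (fun s => dv r u s * T s) volume u v₀ := by
  have hTi : IntervalIntegrable T volume u v₀ :=
    MonotoneOn.intervalIntegrable (by rwa [uIcc_of_le huv])
  rw [intervalIntegrable_iff_integrableOn_Ioc_of_le huv] at hTi ⊢
  refine Integrable.bdd_mul (c := 1 / 2) hTi
    (aestronglyMeasurable_derivWithin_Ioi (fun v' => r u v') _) ?_
  rw [ae_restrict_iff' measurableSet_Ioc]
  refine Eventually.of_forall fun s hs => ?_
  rw [Real.norm_eq_abs, abs_of_pos (h.lam_pos hu hs.1.le)]
  exact h.lam_le_half hu hs.1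

/-- Along an outgoing null curve, `ν` is controlled by the variation of `∂_v (r φ)` and `log λ`. -/
theorem IsBVSolution.neg_nu_le_of_variation (h : IsBVSolution φ r m) {u v₀ F l δ : ℝ}
    (hu : 1 ≤ u) (huv : u < v₀) (hl : 0 < l) (hδ : 0 ≤ δ) (hF0 : 0 ≤ F)
    (hlam : ∀ v, u ≤ v → l ≤ dv r u v) (hF : ∀ v, u < v → |dv (r * φ) u v| ≤ F)
    (hTVf : eVariationOn (fun v => dv (r * φ) u v) (Icc u v₀) ≤ ENNReal.ofReal δ)
    (hTVl : eVariationOn (fun v => Real.log (dv r u v)) (Icc u v₀) ≤ ENNReal.ofReal δ) :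
    -du r u v₀ ≤ Real.exp ((1 + 4 * (F / l) ^ 2) *
      (1 + 2 * (F / l) * (l⁻¹ * δ + F * l⁻¹ * δ))) := by
  obtain ⟨T, hTmono, hT, hosc⟩ :=
    exists_oscillation_control hl hδ hF0 hlam hF hTVf hTVl
  set τ := l⁻¹ * δ + F * l⁻¹ * δ with hτ
  set H := F / l with hH
  set N := 1 + 4 * H ^ 2 with hN
  have hH0 : 0 ≤ H := by positivity
  have hN0 : 0 < N := by positivity
  have hint := h.intervalIntegrable_lam_mul hu huv.le hTmono
  set P : ℝ → ℝ := fun v => ∫ s in u..v, dv r u s * T s with hP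
  have hPac : AbsolutelyContinuousOnInterval P u v₀ :=
    hint.absolutelyContinuousOnInterval_intervalIntegral (by simp)
  have hPd : ∀ᵐ v, v ∈ Ioo u v₀ → HasDerivAt P (dv r u v * T v) v := by
    filter_upwards [hint.ae_hasDerivAt_integral] with v hv hmem
    rw [uIcc_of_le huv.le] at hv
    exact hv (Ioo_subset_Icc_self hmem) u ⟨le_rfl, huv.le⟩
  have hP0 : P u = 0 := by simp [hP]
  have hPnn : ∀ v, u ≤ v → v ≤ v₀ → 0 ≤ P v := fun v h1 h2 =>
    intervalIntegral.integral_nonneg h1 fun s hs =>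
      mul_nonneg (h.lam_pos hu hs.1).le (hT s ⟨hs.1, hs.2.trans h2⟩).1
  have hgH : ∀ v, u < v → |dv (r * φ) u v| ≤ H * dv r u v := by
    intro v hv
    calc |dv (r * φ) u v| ≤ F := hF v hv
      _ = H * l := by rw [hH]; field_simp
      _ ≤ H * dv r u v := by gcongr; exact hlam v hv.le
  have hN' : ∀ v, u < v → N⁻¹ ≤ 1 - massRatio r m u v := fun v hv =>
    h.inv_le_one_sub_massRatio hu hv fun s hs => hgH s hs.1
  -- Since `φ` is the `λ dv`-average of `∂_v (r φ) / λ` and `P / r` is that of `T`, the oscillation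
  -- bound passes to the averages.
  have havg : ∀ v, u < v → v ≤ v₀ →
      |dv (r * φ) u v / dv r u v - φ u v| ≤ T v - P v * (r u v)⁻¹ := by
    intro v hv hv0
    set g := dv (r * φ) u v / dv r u v with hg
    have hrp := h.r_pos u v hu hv
    have key := AbsolutelyContinuousOnInterval.abs_sub_le_of_ae_abs_deriv_le
      (f := fun s => g * r u s - (r * φ) u s) (g := fun s => T v * r u s - P s) hv.le
      (((h.r_ac_v u v hu hv.le).const_mul g).fun_sub (h.rphi_ac_v hu hv.le))
      (((h.r_ac_v u v hu hv.le).const_mul (T v)).fun_sub (hPac.mono_Icc le_rfl hv.le hv0)) ?_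
    · simp only [Pi.mul_apply, h.r_axis u hu, hP0, mul_zero, zero_mul, sub_zero] at key
      have e : g * r u v - r u v * φ u v = (g - φ u v) * r u v := by ring
      rw [e, abs_mul, abs_of_pos hrp] at key
      have := (le_div_iff₀ hrp).2 key
      rwa [sub_div, mul_div_cancel_right₀ _ hrp.ne', div_eq_mul_inv] at this
    filter_upwards [h.ae_r_v hu, h.ae_rphi_v hu, hPd] with s h1 h2 h3 hs a b ha hb
    rw [ha.unique (((h1 hs.1).const_mul g).sub (h2 hs.1)),
      hb.unique (((h1 hs.1).const_mul (T v)).sub (h3 ⟨hs.1, hs.2.trans_le hv0⟩))]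
    have hls := h.lam_pos hu hs.1.le
    have e1 : g * dv r u s - dv (r * φ) u s =
        dv r u s * (g - dv (r * φ) u s / dv r u s) := by field_simp
    have e2 : T v * dv r u s - dv r u s * T s = dv r u s * (T v - T s) := by ring
    rw [e1, e2, abs_mul, abs_of_pos hls]
    exact mul_le_mul_of_nonneg_left (hosc s v hs.1 hs.2.le hv0) hls.le
  -- The integration starts near the axis, where `-ν ≤ λ + 1/2 ≤ 1` and so `log (-ν) ≤ 0`.
  obtain ⟨ε, hε1, hε2⟩ := (((h.nu_add_lam_axis u hu).eventually
    (lt_mem_nhds (show (-(1 / 2) : ℝ) < 0 by norm_num))).and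
    (Ioo_mem_nhdsGT (sub_pos.2 huv))).exists
  set v₁ := u + ε with hv₁
  have h₁ : u < v₁ := by linarith [hε2.1]
  have h₂ : v₁ ≤ v₀ := by linarith [hε2.2]
  have hnu1 : -du r u v₁ ≤ 1 := by linarith [h.lam_le_half hu h₁]
  have hpos : ∀ v ∈ uIcc v₁ v₀, u < v := by
    rw [uIcc_of_le h₂]
    exact fun v hv => h₁.trans_le hv.1
  have hrinv := ((h.r_ac_v u v₀ hu huv.le).mono_Icc h₁.le h₂ le_rfl).inv_of_pos
    fun v hv => h.r_pos u v hu (hpos v hv)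
  have hlog := (h.nu_ac u v₁ v₀ hu h₁ h₂).fun_neg.log_of_pos
    fun v hv => neg_pos.2 (h.nu_neg hu (hpos v hv))
  -- `∂_v log (-ν)` is at most `N · 2 m λ / r²`, which is the `v`-derivative of `-2 N m / r` up to
  -- the flux term `2 N ∂_v m / r`. The flux is quadratic in the deviation of `∂_v (r φ) / λ` from
  -- `φ`: one factor is bounded by `2 H`, the other by `T - P / r`. The resulting `λ (T - P / r) /
  -- r` is exactly `∂_v (P / r)`, whence the first term.
  have key := AbsolutelyContinuousOnInterval.le_of_ae_deriv_nonneg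
    (f := fun v => N * (2 * H) * (P v * (r u v)⁻¹) - N * 2 * (m u v * (r u v)⁻¹) -
      Real.log (-du r u v)) h₂
    (((((hPac.mono_Icc h₁.le h₂ le_rfl).fun_mul hrinv).const_mul (N * (2 * H))).fun_sub
      ((((h.m_ac_v u v₀ hu huv.le).mono_Icc h₁.le h₂ le_rfl).fun_mul hrinv).const_mul
        (N * 2))).fun_sub hlog) ?_
  · have n0 := neg_pos.2 (h.nu_neg hu huv)
    have n1 := neg_pos.2 (h.nu_neg hu h₁)
    rw [← Real.log_le_iff_le_exp n0]
    have a1 : Real.log (-du r u v₁) ≤ 0 := Real.log_nonpos n1.le hnu1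
    have a2 : 0 ≤ m u v₀ * (r u v₀)⁻¹ :=
      mul_nonneg (h.m_nonneg hu huv.le) (inv_nonneg.2 (h.r_nonneg hu huv.le))
    have a3 : 2 * (m u v₁ * (r u v₁)⁻¹) ≤ 1 := by
      have := h.one_sub_massRatio_pos hu h₁
      rw [massRatio, mul_div_assoc, div_eq_mul_inv] at this
      linarith
    have a4 : 0 ≤ P v₁ * (r u v₁)⁻¹ :=
      mul_nonneg (hPnn v₁ h₁.le h₂) (inv_nonneg.2 (h.r_nonneg hu h₁.le))
    have a5 : P v₀ * (r u v₀)⁻¹ ≤ τ := by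
      have := (abs_nonneg _).trans (havg v₀ huv le_rfl)
      linarith [(hT v₀ ⟨huv.le, le_rfl⟩).2]
    have b1 : N * (2 * H) * (P v₀ * (r u v₀)⁻¹) ≤ N * (2 * H) * τ := by gcongr
    have b2 : 0 ≤ N * (2 * H) * (P v₁ * (r u v₁)⁻¹) := by positivity
    have b3 : 0 ≤ N * 2 * (m u v₀ * (r u v₀)⁻¹) := by positivity
    have b4 : N * (2 * (m u v₁ * (r u v₁)⁻¹)) ≤ N * 1 := by gcongr
    linarith
  filter_upwards [h.ae_r_v hu, h.ae_m_v hu, h.ae_nu_v hu, hPd, h.ae_two_mul_dv_m hu]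
    with v c1 c2 c3 c4 c5 hv k hk
  have huv' : u < v := h₁.trans hv.1
  have hrp := h.r_pos u v hu huv'
  have hlp := h.lam_pos hu huv'.le
  have hnp := neg_pos.2 (h.nu_neg hu huv')
  have hmn := h.m_nonneg hu huv'.le
  have hμp := h.one_sub_massRatio_pos hu huv'
  have hμ1 : 1 - massRatio r m u v ≤ 1 := by linarith [h.massRatio_nonneg hu huv']
  have dr := (c1 huv').inv hrp.ne'
  rw [hk.unique (((((c4 ⟨huv', hv.2⟩).mul dr).const_mul (N * (2 * H))).sub
    (((c2 huv').mul dr).const_mul (N * 2))).sub ((c3 huv').neg.log hnp.ne'))]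
  have d1 : -potential r m u v / -du r u v ≤ N * (2 * m u v / r u v ^ 2 * dv r u v) := by
    rw [div_le_iff₀ hnp, h.neg_potential_eq hu huv']
    have : 2 * m u v / ((1 - massRatio r m u v) * r u v ^ 2) ≤ N * (2 * m u v / r u v ^ 2) := by
      have e1 : 1 ≤ N * (1 - massRatio r m u v) := by
        have := hN' v huv'
        rwa [inv_le_iff_one_le_mul₀ hN0, mul_comm] at this
      rw [div_le_iff₀ (by positivity)]
      calc 2 * m u v = 1 * (2 * m u v) := (one_mul _).symm
        _ ≤ N * (1 - massRatio r m u v) * (2 * m u v) := by gcongr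
        _ = _ := by field_simp
    calc _ ≤ N * (2 * m u v / r u v ^ 2) * dv r u v * -du r u v := by gcongr
      _ = _ := by ring
  set x := dv (r * φ) u v / dv r u v - φ u v with hx
  have d2 : 2 * dv m u v ≤ dv r u v * (2 * H * (T v - P v * (r u v)⁻¹)) := by
    have hx1 : |x| ≤ T v - P v * (r u v)⁻¹ := havg v huv' hv.2.le
    have hx2 : |x| ≤ 2 * H := by
      have e1 : |φ u v| ≤ H := h.abs_phi_le hu huv' fun s hs => hgH s hs.1
      have e2 : |dv (r * φ) u v / dv r u v| ≤ H := by
        rw [abs_div, abs_of_pos hlp, div_le_iff₀ hlp]; exact hgH v huv'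
      exact (abs_sub _ _).trans (by linarith)
    rw [c5 huv']
    calc (1 - massRatio r m u v) * (dv r u v * x ^ 2) ≤ 1 * (dv r u v * x ^ 2) := by gcongr
      _ = dv r u v * (|x| * |x|) := by rw [one_mul, ← sq_abs x, sq]
      _ ≤ dv r u v * (2 * H * (T v - P v * (r u v)⁻¹)) := by gcongr
  have d3 : N * (2 * dv m u v) * (r u v)⁻¹ ≤
      N * (dv r u v * (2 * H * (T v - P v * (r u v)⁻¹))) * (r u v)⁻¹ := by gcongr
  have e : N * (2 * H) * (dv r u v * T v * (r u v)⁻¹ + P v * (-dv r u v / r u v ^ 2)) -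
      N * 2 * (dv m u v * (r u v)⁻¹ + m u v * (-dv r u v / r u v ^ 2)) =
      N * (dv r u v * (2 * H * (T v - P v * (r u v)⁻¹))) * (r u v)⁻¹ -
      N * (2 * dv m u v) * (r u v)⁻¹ + N * (2 * m u v / r u v ^ 2 * dv r u v) := by
    field_simp
    ring
  refine le_trans ?_ (sub_le_sub e.ge d1)
  linarith

/-- On late curves the variation estimate bounds `ν` at the point `w` where `r = R`. Before `w`
monotonicity in `v` suffices; beyond it the small mass costs only a factor `e`. -/
theorem IsLocallyBVScattering.exists_neg_nu_le (h : IsLocallyBVScattering φ r m) {F : ℝ}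
    (hF0 : 0 ≤ F) (hF : ∀ u v, 1 ≤ u → u < v → |dv (r * φ) u v| ≤ F) :
    ∃ K : ℝ, 0 < K ∧ ∀ u v, 1 ≤ u → u < v → -du r u v ≤ K := by
  obtain ⟨R, hR, hTVf, hTVl⟩ := h.scattering
  obtain ⟨M, hM, hM0⟩ := h.exists_mass_bound
  obtain ⟨l, hl, hlam⟩ := h.exists_lam_ge
  have hcond := (ENNReal.tendsto_nhds_zero.1 hTVf (ENNReal.ofReal 1) (by simp)).and
    ((ENNReal.tendsto_nhds_zero.1 hTVl (ENNReal.ofReal 1) (by simp)).and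
    (hM0.eventually (ge_mem_nhds (show (0 : ℝ) < R / 4 by positivity))))
  obtain ⟨U₁, hU₁⟩ := eventually_atTop.1 hcond
  obtain ⟨K₁, hK₁, hnu₁⟩ := h.exists_neg_nu_le_of_le (le_max_right U₁ 1)
  set K₂ := Real.exp ((1 + 4 * (F / l) ^ 2) *
      (1 + 2 * (F / l) * (l⁻¹ * 1 + F * l⁻¹ * 1))) with hK₂
  have hK₂0 : 0 < K₂ := Real.exp_pos _
  have he : 1 ≤ Real.exp 1 := Real.one_le_exp zero_le_one
  refine ⟨max K₁ (Real.exp 1 * K₂), lt_max_of_lt_left hK₁, fun u v hu huv => ?_⟩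
  rcases le_or_gt u (max U₁ 1) with hle | hgt
  · exact (hnu₁ u v hu hle huv).trans (le_max_left _ _)
  refine le_trans ?_ (le_max_right _ _)
  obtain ⟨tf, tl, hMu⟩ := hU₁ u ((le_max_left _ _).trans hgt.le)
  obtain ⟨w, huw, hw⟩ := h.exists_r_eq hu le_rfl (R := R) (by rw [h.r_axis u hu]; exact hR.le)
  have huw' : u < w := by
    refine lt_of_le_of_ne huw fun heq => ?_
    rw [← heq, h.r_axis u hu] at hw
    exact hR.ne hw
  have hsub : Icc u w ⊆ {v | u ≤ v ∧ r u v ≤ R} := fun s hs =>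
    ⟨hs.1, hw ▸ h.r_mono_v hu hs.1 hs.2⟩
  have hKw : -du r u w ≤ K₂ := h.neg_nu_le_of_variation hu huw' hl zero_le_one hF0
    (fun v hv => hlam u v hu hv) (fun v hv => hF u v hu hv)
    ((eVariationOn.mono _ hsub).trans tf) ((eVariationOn.mono _ hsub).trans tl)
  rcases le_or_gt v w with hv | hv
  · have := h.nu_anti hu huv hv
    nlinarith
  · refine (h.neg_nu_le_exp_one_mul hu huw' hv.le (hM u v hu huv.le) (by linarith)).trans ?_
    gcongr

end SSESF

namespace SSESF

variable {φ r m : ℝ → ℝ → ℝ}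

/-! ### Decay -/

theorem IsBVSolution.abs_phi_le_of_rpow (h : IsBVSolution φ r m) {u v l X ω : ℝ} (hu : 1 ≤ u)
    (huv : u < v) (hl : 0 < l) (hX : 0 ≤ X) (hω : 1 < ω)
    (hlam : ∀ u v, 1 ≤ u → u ≤ v → l ≤ dv r u v)
    (hf : ∀ s, u < s → |dv (r * φ) u s| ≤ X * s ^ (-ω)) :
    |φ u v| ≤ X / l * u ^ (-ω) ∧ |r u v * φ u v| ≤ X / (ω - 1) * u ^ (-(ω - 1)) := by
  have hu0 : 0 < u := by linarith
  constructor
  · have := h.abs_phi_le_div hu huv hl (show 0 ≤ X * u ^ (-ω) by positivity) hlam fun s hs => by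
      refine (hf s hs.1).trans ?_
      exact mul_le_mul_of_nonneg_left
        (Real.rpow_le_rpow_of_nonpos hu0 hs.1.le (by linarith)) hX
    calc |φ u v| ≤ X * u ^ (-ω) / l := this
      _ = _ := by ring
  · have := h.abs_rphi_sub_le_of_rpow hu le_rfl huv.le hω hX le_rfl fun s hs => by
      rw [zero_mul, add_zero]
      exact hf s hs.1
    rw [h.r_axis u hu, zero_mul, sub_zero, zero_mul, add_zero, ← neg_sub ω 1] at this
    calc _ ≤ _ := this
      _ = _ := by ring

/-- The right-hand side of the wave equation under the expected decay of `∂_v (r φ)`. -/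
theorem IsBVSolution.neg_potential_mul_abs_phi_le_of_decay (h : IsBVSolution φ r m)
    {u v l M K X ω : ℝ} (hu : 1 ≤ u) (huv : u < v) (hl : 0 < l) (hX : 0 ≤ X) (hω : 1 < ω)
    (hω3 : ω ≤ 3) (hlam : ∀ u v, 1 ≤ u → u ≤ v → l ≤ dv r u v)
    (hf : ∀ s, u < s → |dv (r * φ) u s| ≤ X * s ^ (-ω)) (hM : m u v ≤ M) (hMu : 8 * M ≤ l * u)
    (hK : -du r u v ≤ K) :
    -potential r m u v * |φ u v| ≤
      (8 / l + 16 * M * K / l ^ 3 / (ω - 1)) * X * v ^ (-ω) * ((u ^ 2)⁻¹ - potential r m u v) := by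
  have hu0 : 0 < u := by linarith
  have hv0 : 0 < v := by linarith
  have hω1 : 0 < ω - 1 := by linarith
  have hM0 := (h.m_nonneg hu huv.le).trans hM
  have hK0 : 0 ≤ K := by linarith [h.nu_neg hu huv]
  have hp := neg_nonneg.2 (h.potential_nonpos hu huv)
  obtain ⟨h1, h2⟩ := h.abs_phi_le_of_rpow hu huv hl hX hω hlam hf
  set p := -potential r m u v with hpdef
  set C := 16 * M * K / l ^ 3 with hC
  have hC0 : 0 ≤ C := by positivity
  have q1 : 0 ≤ 8 / l * X * v ^ (-ω) * (u ^ 2)⁻¹ := by positivity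
  have q2 : 0 ≤ C / (ω - 1) * X * v ^ (-ω) * p := by positivity
  have q3 : 0 ≤ C / (ω - 1) * X * v ^ (-ω) * (u ^ 2)⁻¹ := by positivity
  have q4 : 0 ≤ 8 / l * X * v ^ (-ω) * p := by positivity
  have hsum : (8 / l + C / (ω - 1)) * X * v ^ (-ω) * ((u ^ 2)⁻¹ - potential r m u v) =
      8 / l * X * v ^ (-ω) * (u ^ 2)⁻¹ + C / (ω - 1) * X * v ^ (-ω) * p +
      C / (ω - 1) * X * v ^ (-ω) * (u ^ 2)⁻¹ + 8 / l * X * v ^ (-ω) * p := by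
    rw [hpdef]; ring
  rw [hsum]
  rcases le_or_gt v (2 * u) with hv | hv
  -- Near zone: the potential is kept intact, because it integrates in `u` to the small drop of `λ`.
  · have h3 : u ^ (-ω) ≤ 8 * v ^ (-ω) :=
      calc u ^ (-ω) ≤ (v / 2) ^ (-ω) :=
            Real.rpow_le_rpow_of_nonpos (by positivity) (by linarith) (by linarith)
        _ = 2 ^ ω * v ^ (-ω) := by
            rw [Real.div_rpow hv0.le (by norm_num), Real.rpow_neg (by norm_num : (0 : ℝ) ≤ 2),
              div_inv_eq_mul, mul_comm]
        _ ≤ 2 ^ (3 : ℝ) * v ^ (-ω) := by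
            gcongr
            norm_num
        _ = 8 * v ^ (-ω) := by norm_num
    have h4 : p * |φ u v| ≤ 8 / l * X * v ^ (-ω) * p :=
      calc p * |φ u v| ≤ p * (X / l * (8 * v ^ (-ω))) := by
            gcongr
            exact h1.trans (by gcongr)
        _ = _ := by ring
    linarith
  · have h3 := h.le_r_sub hu le_rfl huv.le fun s hs => hlam u s hu hs.1.le
    rw [h.r_axis u hu, sub_zero] at h3
    have h4 := h.neg_potential_mul_abs_phi_le hu hv.le hl h3 hM
      (hMu.trans (by gcongr)) hK
    -- Far zone: as `ω ≤ 3`, the surplus `u ^ (3 - ω)` may be replaced by `v ^ (3 - ω)`, which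
    -- leaves an integrable `u⁻²`.
    have h5 : u ^ (-(ω - 1)) ≤ (u ^ 2)⁻¹ * v ^ (3 - ω) := by
      have : u ^ (-(ω - 1)) = (u ^ 2)⁻¹ * u ^ (3 - ω) := by
        rw [← Real.rpow_two, ← Real.rpow_neg hu0.le, ← Real.rpow_add hu0]
        ring_nf
      rw [this]
      gcongr
    have h6 : v ^ (-3 : ℝ) * v ^ (3 - ω) = v ^ (-ω) := by
      rw [← Real.rpow_add hv0]
      ring_nf
    have h7 : p * |φ u v| ≤ C / (ω - 1) * X * v ^ (-ω) * (u ^ 2)⁻¹ :=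
      calc p * |φ u v| ≤ C * v ^ (-3 : ℝ) * |r u v * φ u v| := h4
        _ ≤ C * v ^ (-3 : ℝ) * (X / (ω - 1) * ((u ^ 2)⁻¹ * v ^ (3 - ω))) := by
            gcongr
            exact h2.trans (by gcongr)
        _ = C / (ω - 1) * X * (v ^ (-3 : ℝ) * v ^ (3 - ω)) * (u ^ 2)⁻¹ := by ring
        _ = _ := by rw [h6]
    linarith

/-- The weighted loop: past `U₁` the source integrates to at most `A (U₁⁻¹ + η) X v ^ (-ω)`, where
`U₁⁻¹` is the tail of `∫ u⁻² du` and `η` bounds the drop of `λ`. Both are chosen so that `A (U₁⁻¹ +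
η) ≤ 1/2`. -/
theorem IsLocallyBVScattering.exists_abs_dv_rphi_le_rpow (h : IsLocallyBVScattering φ r m)
    {ω I l K : ℝ} (hω : 1 < ω) (hω3 : ω ≤ 3) (hI : 0 ≤ I)
    (hinit : ∀ v, 1 ≤ v → |dv (r * φ) 1 v| ≤ I * v ^ (-ω)) (hl : 0 < l)
    (hlam : ∀ u v, 1 ≤ u → u ≤ v → l ≤ dv r u v) (hK : 0 < K)
    (hnu : ∀ u v, 1 ≤ u → u < v → -du r u v ≤ K) :
    ∃ B : ℝ, 0 ≤ B ∧ ∀ u v, 1 ≤ u → u < v → |dv (r * φ) u v| ≤ B * v ^ (-ω) := by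
  obtain ⟨M, hM, -⟩ := h.exists_mass_bound
  have hM1 : 0 ≤ M 1 := (h.m_nonneg le_rfl le_rfl).trans (hM 1 1 le_rfl le_rfl)
  have hω1 : 0 < ω - 1 := by linarith
  set A := 8 / l + 16 * M 1 * K / l ^ 3 / (ω - 1) with hA
  have hA0 : 0 < A := by positivity
  set η := min (1 / (4 * A)) (1 / 4) with hη
  have hη0 : 0 < η := by positivity
  have hη4 : η ≤ 1 / 4 := min_le_right _ _
  have hAη : A * η ≤ 1 / 4 :=
    calc A * η ≤ A * (1 / (4 * A)) := by gcongr; exact min_le_left _ _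
      _ = 1 / 4 := by field_simp
  obtain ⟨U₀, hU₀, hlam₀⟩ := h.exists_forall_lam_ge (l := 1 / 2 - η) (by linarith) (by linarith)
  set U₁ := max U₀ (max (4 * A) (8 * M 1 / l)) with hU₁def
  have hU₁ : 1 ≤ U₁ := hU₀.trans (le_max_left _ _)
  have hAU : A * U₁⁻¹ ≤ 1 / 4 := by
    have : 4 * A ≤ U₁ := (le_max_left _ _).trans (le_max_right _ _)
    rw [← div_eq_mul_inv, div_le_iff₀ (by linarith)]
    linarith
  have hMU : 8 * M 1 ≤ l * U₁ := by
    have : 8 * M 1 / l ≤ U₁ := (le_max_right _ _).trans (le_max_right _ _)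
    rwa [div_le_iff₀' hl] at this
  obtain ⟨C, hC, hCf⟩ := h.exists_abs_dv_rphi_le_of_le hω hω3 hI hinit hU₁
  have weight : ∀ {u v X : ℝ}, 0 < v →
      (v ^ ω * |dv (r * φ) u v| ≤ X ↔ |dv (r * φ) u v| ≤ X * v ^ (-ω)) := by
    intro u v X hv
    rw [Real.rpow_neg hv.le, ← div_eq_mul_inv, le_div_iff₀' (by positivity)]
  have late : ∀ U, ∀ p : {p : ℝ × ℝ // (U₁ ≤ p.1 ∧ p.1 ≤ U) ∧ p.1 < p.2},
      p.1.2 ^ ω * |dv (r * φ) p.1.1 p.1.2| ≤ 2 * C := by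
    intro U
    refine le_two_mul_of_improvable ?_ ?_
    · obtain ⟨D, -, hD⟩ := h.exists_abs_dv_rphi_le_of_le hω hω3 hI hinit (le_max_right U 1)
      refine ⟨D, ?_⟩
      rintro _ ⟨⟨⟨u, v⟩, ⟨hu, huU⟩, huv⟩, rfl⟩
      dsimp only at hu huU huv ⊢
      exact (weight (by linarith)).2
        (hD u v (hU₁.trans hu) (huU.trans (le_max_left _ _)) huv)
    · rintro X hX ⟨⟨u, v⟩, ⟨hu, huU⟩, huv⟩
      dsimp only at hu huU huv ⊢
      have hv1 : 1 < v := (hU₁.trans hu).trans_lt huv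
      have hv0 : 0 < v := by linarith
      have hX0 : 0 ≤ X :=
        le_trans (by positivity) (hX ⟨⟨u, v⟩, ⟨hu, huU⟩, huv⟩)
      have hf : ∀ u', U₁ ≤ u' → u' ≤ U → ∀ s, u' < s →
          |dv (r * φ) u' s| ≤ X * s ^ (-ω) := fun u' h1 h2 s hs =>
        (weight (by linarith)).1 (hX ⟨⟨u', s⟩, ⟨h1, h2⟩, hs⟩)
      -- The comparison function is the `u`-primitive of the source bound: `-u⁻¹` has derivative
      -- `u⁻²`, and `-λ` has derivative minus the potential.
      have key := h.abs_dv_rphi_sub_le hU₁ hu huv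
        (g := fun u' => A * X * v ^ (-ω) * (-u'⁻¹ - dv r u' v))
        ((((AbsolutelyContinuousOnInterval.id U₁ u).inv_of_pos fun x hx => by
          rw [uIcc_of_le hu] at hx; linarith [hx.1]).fun_neg.fun_sub
          ((h.lam_ac u v (hU₁.trans hu) huv).mono_Icc hU₁ hu le_rfl)).const_mul _) ?_
      · have h1 := abs_sub_abs_le_abs_sub (dv (r * φ) u v) (dv (r * φ) U₁ v)
        have h2 := hCf U₁ v hU₁ le_rfl (hu.trans_lt huv)
        have h3 : A * X * v ^ (-ω) * (-u⁻¹ - dv r u v) -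
            A * X * v ^ (-ω) * (-U₁⁻¹ - dv r U₁ v) ≤ X / 2 * v ^ (-ω) := by
          have h4 : 0 ≤ u⁻¹ := inv_nonneg.2 (by linarith)
          have h5 := h.lam_le_half hU₁ (hu.trans_lt huv)
          have h6 := hlam₀ u v ((le_max_left _ _).trans hu) huv.le
          have h7 : -u⁻¹ - dv r u v - (-U₁⁻¹ - dv r U₁ v) ≤ U₁⁻¹ + η := by linarith
          calc _ = X * v ^ (-ω) * (A * (-u⁻¹ - dv r u v - (-U₁⁻¹ - dv r U₁ v))) := by ring
            _ ≤ X * v ^ (-ω) * (A * (U₁⁻¹ + η)) := by gcongr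
            _ ≤ X * v ^ (-ω) * (1 / 2) := by gcongr; linarith
            _ = _ := by ring
        exact (weight hv0).2 (by linarith)
      filter_upwards [h.ae_lam_u hv1] with u' h3 hu' g' hg'
      have hu'1 : 1 < u' := hU₁.trans_lt hu'.1
      have hu'v : u' < v := hu'.2.trans huv
      rw [hg'.unique (((hasDerivAt_inv (by linarith : u' ≠ 0)).neg.sub
        (h3 ⟨hu'1, hu'v⟩)).const_mul (A * X * v ^ (-ω))), neg_neg]
      exact h.neg_potential_mul_abs_phi_le_of_decay hu'1.le hu'v hl hX0 hω hω3 hlam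
        (hf u' hu'.1.le (hu'.2.le.trans huU))
        ((h.m_anti_u le_rfl hu'1.le hu'v.le).trans (hM 1 v le_rfl hv1.le))
        (hMU.trans (by gcongr; exact hu'.1.le)) (hnu u' v hu'1.le hu'v)
  refine ⟨2 * C, by positivity, fun u v hu huv => ?_⟩
  have hv0 : 0 < v := by linarith
  rcases le_or_gt u U₁ with hle | hgt
  · refine (hCf u v hu hle huv).trans ?_
    gcongr
    linarith
  · exact (weight hv0).1 (late u ⟨⟨u, v⟩, ⟨hgt.le, le_rfl⟩, huv⟩)

/-- Near the axis `∂_u (r φ)` is close to `-∂_v (r φ)`, which gives `E`. Outward, `∂_v ∂_u (r φ) = φ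
∂_v ν`, and `ν` is monotone with values in `[-K, 0]`, which gives `D K`. -/
theorem IsBVSolution.abs_du_rphi_le (h : IsBVSolution φ r m) {u v K D E : ℝ} (hu : 1 ≤ u)
    (huv : u < v) (hnu : -du r u v ≤ K) (hD0 : 0 ≤ D) (hD : ∀ s, u < s → |φ u s| ≤ D)
    (hE : ∀ s, u < s → |dv (r * φ) u s| < E) : |du (r * φ) u v| ≤ E + D * K := by
  refine le_of_forall_pos_le_add fun e he => ?_
  obtain ⟨ε, hε1, hε2⟩ := (((h.rphi_axis u hu).abs.eventually
    (gt_mem_nhds (show |(0 : ℝ)| < e by simpa))).and (Ioo_mem_nhdsGT (sub_pos.2 huv))).exists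
  set v₁ := u + ε
  have h₁ : u < v₁ := by linarith [hε2.1]
  have h₂ : v₁ ≤ v := by linarith [hε2.2]
  have key := AbsolutelyContinuousOnInterval.abs_sub_le_of_ae_abs_deriv_le
    (f := fun s => du (r * φ) u s) (g := fun s => -D * du r u s) h₂
    (h.du_rphi_ac u v₁ v hu h₁ h₂) ((h.nu_ac u v₁ v hu h₁ h₂).const_mul (-D)) ?_
  · have h3 := abs_sub_abs_le_abs_sub (du (r * φ) u v) (du (r * φ) u v₁)
    have h4 := abs_sub_abs_le_abs_sub (du (r * φ) u v₁) (-dv (r * φ) u v₁)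
    rw [abs_neg, sub_neg_eq_add, add_comm (du (r * φ) u v₁)] at h4
    have h5 := hE v₁ h₁
    have h6 : D * (du r u v₁ - du r u v) ≤ D * K := by
      gcongr
      linarith [h.nu_neg hu h₁]
    linarith
  filter_upwards [h.ae_du_rphi_v hu, h.ae_nu_v hu] with s h3 h4 hs a b ha hb
  have hus : u < s := h₁.trans hs.1
  rw [ha.unique (h3 hus), hb.unique ((h4 hus).const_mul (-D)), abs_mul,
    abs_of_nonpos (h.potential_nonpos hu hus)]
  nlinarith [h.potential_nonpos hu hus, hD s hus]

theorem IsSolution.abs_phi_axis_le (h : IsSolution φ r m) {u D : ℝ} (hu : 1 ≤ u)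
    (hD : ∀ s, u < s → |φ u s| ≤ D) : |φ u u| ≤ D := by
  have hcont := (h.phi_ac_v u (u + 1) hu (by linarith)).continuousOn
  rw [uIcc_of_le (by linarith)] at hcont
  have h1 : Tendsto (fun s => φ u s) (𝓝[>] u) (𝓝 (φ u u)) := by
    have h2 := hcont u ⟨le_rfl, by linarith⟩
    rw [← nhdsWithin_Ioc_eq_nhdsGT (show u < u + 1 by linarith)]
    exact h2.mono Ioc_subset_Icc_self
  refine le_of_tendsto h1.abs ?_
  filter_upwards [self_mem_nhdsWithin] with s hs using hD s hs

theorem IsBVSolution.abs_dv_rphi_axis_le (h : IsBVSolution φ r m) {u D : ℝ} (hu : 1 ≤ u)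
    (hD : ∀ s, u < s → |φ u s| ≤ D) : |dv (r * φ) u u| ≤ D := by
  have hD0 : 0 ≤ D := (abs_nonneg _).trans (hD (u + 1) (by linarith))
  by_cases hdiff : DifferentiableWithinAt ℝ (fun v' => (r * φ) u v') (Ioi u) u
  · have h1 := hdiff.hasDerivWithinAt
    rw [hasDerivWithinAt_iff_tendsto_slope' (by simp)] at h1
    refine le_of_tendsto h1.abs ?_
    filter_upwards [self_mem_nhdsWithin] with s hs
    rw [mem_Ioi] at hs
    have h2 := h.r_le hu hs.le
    have h3 := h.r_nonneg hu hs.le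
    have h4 : 0 < s - u := sub_pos.2 hs
    rw [slope_def_field, Pi.mul_apply, Pi.mul_apply, Pi.mul_apply, h.r_axis u hu,
      zero_mul, sub_zero, abs_div, abs_mul, abs_of_nonneg h3, abs_of_pos h4, div_le_iff₀ h4]
    calc r u s * |φ u s| ≤ (s - u) * D := by
          gcongr
          · linarith
          · exact hD s hs
      _ = D * (s - u) := mul_comm _ _
  -- Without a right derivative at the axis, `derivWithin` takes the default value `0`.
  · rw [dv, derivWithin_zero_of_not_differentiableWithinAt hdiff, abs_zero]
    exact hD0

end SSESF

/-! ### Conclusion: from decay in `v` to decay in `u` and `r` -/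

theorem theorem3p1 (φ r m : ℝ → ℝ → ℝ) (ω' ω : ℝ) (hω' : 1 < ω') (hω : ω = min ω' 3)
    (hsol : SSESF.IsLocallyBVScattering φ r m)
    (hflat : SSESF.IsAsymptoticallyFlatBV φ r ω') :
    ∃ A₁ : ℝ, 0 < A₁ ∧
      -- off the axis, where `r > 0`
      (∀ u v : ℝ, 1 ≤ u → u < v →
        |φ u v| ≤ A₁ * min (u ^ (-ω)) ((r u v)⁻¹ * u ^ (-(ω - 1))) ∧
        |SSESF.dv (r * φ) u v| ≤ A₁ * min (u ^ (-ω)) ((r u v) ^ (-ω)) ∧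
        |SSESF.du (r * φ) u v| ≤ A₁ * u ^ (-ω)) ∧
      -- on the axis, where `r = 0` and both minima are `u ^ (-ω)`
      (∀ u : ℝ, 1 ≤ u →
        |φ u u| ≤ A₁ * u ^ (-ω) ∧ |SSESF.dv (r * φ) u u| ≤ A₁ * u ^ (-ω)) := by
  have hω1 : 1 < ω := hω ▸ lt_min hω' (by norm_num)
  have hω3 : ω ≤ 3 := hω ▸ min_le_right _ _
  have hωle : ω ≤ ω' := hω ▸ min_le_left _ _
  obtain ⟨I, hI, hinit⟩ :=
    SSESF.exists_abs_dv_rphi_initial_le hsol.toIsSolution hω1 hωle hflat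
  obtain ⟨F, hF0, hF⟩ := hsol.exists_abs_dv_rphi_le hω1 hω3 hI.le hinit
  obtain ⟨K, hK, hnu⟩ := hsol.exists_neg_nu_le hF0 hF
  obtain ⟨l, hl, hlam⟩ := hsol.exists_lam_ge
  obtain ⟨B, hB, hdecay⟩ :=
    hsol.exists_abs_dv_rphi_le_rpow hω1 hω3 hI.le hinit hl hlam hK hnu
  have hω10 : 0 < ω - 1 := by linarith
  have hφ : ∀ u v, 1 ≤ u → u < v → |φ u v| ≤ B / l * u ^ (-ω) ∧
      |r u v * φ u v| ≤ B / (ω - 1) * u ^ (-(ω - 1)) := fun u v hu huv =>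
    hsol.abs_phi_le_of_rpow hu huv hl hB hω1 hlam fun s hs => hdecay u s hu hs
  have hdu : ∀ u v, 1 ≤ u → u < v → |SSESF.dv (r * φ) u v| ≤ B * u ^ (-ω) := by
    intro u v hu huv
    refine (hdecay u v hu huv).trans ?_
    exact mul_le_mul_of_nonneg_left
      (Real.rpow_le_rpow_of_nonpos (by linarith) huv.le (by linarith)) hB
  have c1 : 0 ≤ B / l := by positivity
  have c2 : 0 ≤ B / (ω - 1) := by positivity
  have c3 : 0 ≤ B / l * K := by positivity
  set A := B + 1 + B / l + B / (ω - 1) + B / l * K with hA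
  have le_A : ∀ {c x : ℝ}, c ≤ A → 0 ≤ x → c * x ≤ A * x := fun hc hx =>
    mul_le_mul_of_nonneg_right hc hx
  refine ⟨A, by positivity, fun u v hu huv => ⟨?_, ?_, ?_⟩, fun u hu => ⟨?_, ?_⟩⟩
  · have hr := hsol.r_pos u v hu huv
    have hu0 : 0 < u := by linarith
    rw [mul_min_of_nonneg _ _ (by positivity)]
    refine le_min ((hφ u v hu huv).1.trans (le_A (by linarith) (by positivity))) ?_
    have h1 := (hφ u v hu huv).2
    rw [abs_mul, abs_of_pos hr] at h1
    calc |φ u v| = (r u v)⁻¹ * (r u v * |φ u v|) := by field_simp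
      _ ≤ (r u v)⁻¹ * (B / (ω - 1) * u ^ (-(ω - 1))) := by gcongr
      _ = B / (ω - 1) * ((r u v)⁻¹ * u ^ (-(ω - 1))) := by ring
      _ ≤ _ := le_A (by linarith) (by positivity)
  · have hr := hsol.r_pos u v hu huv
    have hu0 : 0 < u := by linarith
    have hrv : r u v ≤ v := by linarith [hsol.r_le hu huv.le]
    rw [mul_min_of_nonneg _ _ (by positivity)]
    refine le_min ((hdu u v hu huv).trans (le_A (by linarith) (by positivity))) ?_
    refine (hdecay u v hu huv).trans ?_
    calc B * v ^ (-ω) ≤ B * r u v ^ (-ω) :=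
          mul_le_mul_of_nonneg_left (Real.rpow_le_rpow_of_nonpos hr hrv (by linarith)) hB
      _ ≤ _ := le_A (by linarith) (by positivity)
  · have hu0 : 0 < u := by linarith
    have hp : 0 < u ^ (-ω) := by positivity
    have h1 := hsol.abs_du_rphi_le hu huv (hnu u v hu huv)
      -- `B + 1` instead of `B` provides the strict inequality required of `E`, even when `B = 0`.
      (D := B / l * u ^ (-ω)) (E := (B + 1) * u ^ (-ω)) (by positivity)
      (fun s hs => (hφ u s hu hs).1) (fun s hs => by linarith [hdu u s hu hs])
    calc _ ≤ _ := h1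
      _ = (B + 1 + B / l * K) * u ^ (-ω) := by ring
      _ ≤ _ := le_A (by linarith) hp.le
  · have hu0 : 0 < u := by linarith
    exact (hsol.abs_phi_axis_le hu fun s hs => (hφ u s hu hs).1).trans
      (le_A (by linarith) (by positivity))
  · have hu0 : 0 < u := by linarith
    exact (hsol.abs_dv_rphi_axis_le hu fun s hs => (hφ u s hu hs).1).trans
      (le_A (by linarith) (by positivity))
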